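/- Let $p\ge 1$ be an integer, and let $\mathcal E_p=\{(z_1,z_2)\in\mathbb C^2:|z_1|^{2p}+|z_2|^{2p}<1\}$, with boundary $b\mathcal E_p$. Let $\sigma$ be the Euclidean surface area measure on $b\mathcal E_p$, and let $\omega_p=j^*(d^c\varphi_p\wedge dd^c\varphi_p)$ be the Monge–Ampère boundary measure of $\varphi_p(z)=\frac1{2p}\log(|z_1|^{2p}+|z_2|^{2p})$, where $d^c=i(\bar\partial-\partial)$ and $j:b\mathcal E_p\to\mathbb C^2$ is the inclusion. For $\nu\in\{\sigma,\omega_p\}$, let $\mathfrak H^2(\mathcal E_p,\nu)$ be the closure in $L^2(\nu)$ of the set of restrictions $F|_{\operatorname{supp}\nu}$ of functions $F$ that are holomorphic on $\mathcal E_p$ and continuous on $\mathcal E_p\cup\operatorname{supp}\nu$. Use coordinates $(s,\theta_1,\theta_2)\in(0,1)\times[0,2\pi)^2$ on $b\mathcal E_p\setminus\{z_1z_2=0\}$, given by $(z_1,z_2)=\big(s^{1/2p}e^{i\theta_1},(1-s)^{1/2p}e^{i\theta_2}\big)$; the omitted set is null for both measures. Let $\beta(x,y)=\int_0^1 s^{x-1}(1-s)^{y-1}\,ds$.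 Then $$\mathfrak H^2(\mathcal E_p,\sigma)=\Big\{\sum_{j,\ell\ge0}a_{j,\ell}\,s^{\frac j{2p}}(1-s)^{\frac\ell{2p}}e^{i(j\theta_1+\ell\theta_2)}:\ \sum_{j,\ell\ge0}|a_{j,\ell}|^2\,\beta\big(\tfrac{j+1}p,\tfrac{\ell+1}p\big)<\infty\Big\},$$ $$\mathfrak H^2(\mathcal E_p,\omega_p)=\Big\{\sum_{j,\ell\ge0}a_{j,\ell}\,s^{\frac j{2p}}(1-s)^{\frac\ell{2p}}e^{i(j\theta_1+\ell\theta_2)}:\ \sum_{j,\ell\ge0}|a_{j,\ell}|^2\,\beta\big(\tfrac jp+1,\tfrac\ell p+1\big)<\infty\Big\},$$ where, for every such family of complex coefficients $(a_{j,\ell})$, the series converges (unconditionally) in $L^2(\sigma)$, respectively $L^2(\omega_p)$. The measures $\sigma$ and $\omega_p$ have the same null sets, and, as spaces of functions on $b\mathcal E_p$ modulo null sets, $\mathfrak H^2(\mathcal E_1,\sigma)=\mathfrak H^2(\mathcal E_1,\omega_1)$, while $\mathfrak H^2(\mathcal E_p,\sigma)\subsetneq\mathfrak H^2(\mathcal E_p,\omega_p)$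 when $p>1$. -/

import Mathlib

open MeasureTheory Filter Topology
open scoped ENNReal

/-- The space `ℂ²` with its Euclidean metric; coordinates `z 0`, `z 1` stand for `z₁`, `z₂`. -/
abbrev C2 : Type := EuclideanSpace ℂ (Fin 2)

noncomputable section

/-! ### Hardy spaces of a domain with a boundary measure -/

/-- `𝒜(Ω, ν) = 𝒪(Ω) ∩ 𝒞(Ω ∪ supp ν)`. Functions are total on `ℂ²`; only their values on
`Ω ∪ supp ν` matter. -/
def algA (Ω : Set C2) (ν : Measure C2) : Set (C2 → ℂ) :=
  {F | DifferentiableOn ℂ F Ω ∧ ContinuousOn F (Ω ∪ ν.support)}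

/-- `𝔥²(Ω, ν)`: the closure in `L²(ν)` of the restrictions to `supp ν` of functions in
`𝒜(Ω, ν)` (the complement of `supp ν` is `ν`-null). -/
def hardySpace (Ω : Set C2) (ν : Measure C2) : Set (Lp ℂ 2 ν) :=
  closure {f | ∃ F ∈ algA Ω ν, f =ᵐ[ν] F}

/-- The functions whose class modulo `ν`-null sets belongs to `𝔥²(Ω, ν)`. -/
def hardyFunctions (Ω : Set C2) (ν : Measure C2) : Set (C2 → ℂ) :=
  {f | ∃ hf : MemLp f 2 ν, hf.toLp f ∈ hardySpace Ω ν}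

/-! ### Surface measure and Monge–Ampère boundary measure -/

/-- Euclidean surface area on the boundary of a domain in `ℂ² = ℝ⁴`: three-dimensional Hausdorff
measure, normalized to agree with Lebesgue measure on three-dimensional subspaces. -/
def surfaceMeasure (Ω : Set C2) : Measure C2 :=
  (μHE[3] : Measure C2).restrict (frontier Ω)

/-- The `1`-form `dᶜφ = i(∂̄φ - ∂φ)`. Since `∂φ(v) = (dφ(v) - i dφ(iv)) / 2` and
`∂̄φ(v) = (dφ(v) + i dφ(iv)) / 2`, it is `dᶜφ(v) = -dφ(iv)`. -/
def dc (φ : C2 → ℝ) (z : C2) : C2 [⋀^Fin 1]→L[ℝ] ℝ :=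
  ContinuousAlternatingMap.ofSubsingleton ℝ C2 ℝ 0
    (-(fderiv ℝ φ z).comp ((Complex.I • ContinuousLinearMap.id ℂ C2).restrictScalars ℝ))

/-- The `2`-form `ddᶜφ`. -/
def ddc (φ : C2 → ℝ) (z : C2) : C2 [⋀^Fin 2]→L[ℝ] ℝ := extDeriv (dc φ) z

/-- The `3`-form `dᶜφ ∧ ddᶜφ`, evaluated on three tangent vectors. -/
def dcWedgeDdc (φ : C2 → ℝ) (z u v w : C2) : ℝ :=
  dc φ z ![u] * ddc φ z ![v, w] - dc φ z ![v] * ddc φ z ![u, w] + dc φ z ![w] * ddc φ z ![u, v]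

/-- The Euclidean gradient of `φ` as a vector of `ℂ²`: its `j`-th entry is
`∂φ/∂xⱼ + i ∂φ/∂yⱼ`, where `zⱼ = xⱼ + i yⱼ`. -/
def realGrad (φ : C2 → ℝ) (z : C2) : C2 :=
  WithLp.toLp 2 fun j =>
    (fderiv ℝ φ z (EuclideanSpace.single j 1) : ℂ)
      + Complex.I * (fderiv ℝ φ z (EuclideanSpace.single j Complex.I) : ℂ)

/-- The unit vector in the direction of the gradient: the outer unit normal of `{φ < 0}`. -/
def unitNormal (φ : C2 → ℝ) (z : C2) : C2 :=
  (‖realGrad φ z‖⁻¹ : ℝ) • realGrad φ z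

/-- For a unit vector `n`, a unit vector spanning the complex-orthogonal complement of `n`.
Thus `(n, i n, m, i m)` is a positively oriented orthonormal basis of `ℝ⁴`. -/
def complexTangent (n : C2) : C2 := !₂[-(starRingEnd ℂ) (n 1), (starRingEnd ℂ) (n 0)]

/-- The Monge–Ampère boundary measure `j^*(dᶜφ ∧ ddᶜφ)` of `Ω = {φ < 0}`, where
`j : bΩ → ℂ²` is the inclusion: the measure on `bΩ` whose density with respect to surface area is
the value of the `3`-form on the oriented orthonormal frame `(i n, m, i m)` of the tangent space,
with `n` the outer unit normal. -/
def mongeAmpereMeasure (Ω : Set C2) (φ : C2 → ℝ) : Measure C2 :=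
  (surfaceMeasure Ω).withDensity fun z =>
    ENNReal.ofReal
      (dcWedgeDdc φ z
        (Complex.I • unitNormal φ z)
        (complexTangent (unitNormal φ z))
        (Complex.I • complexTangent (unitNormal φ z)))

/-! ### Egg domains -/

/-- `𝓔ₚ = {|z₁|^{2p} + |z₂|^{2p} < 1}`. -/
def egg (p : ℕ) : Set C2 := {z | ‖z 0‖ ^ (2 * p) + ‖z 1‖ ^ (2 * p) < 1}

/-- `φₚ(z) = (1 / 2p) log (|z₁|^{2p} + |z₂|^{2p})`. -/
def eggExhaustion (p : ℕ) (z : C2) : ℝ :=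
  1 / (2 * p) * Real.log (‖z 0‖ ^ (2 * p) + ‖z 1‖ ^ (2 * p))

/-- The surface measure `σ` on `b𝓔ₚ`. -/
def eggSigma (p : ℕ) : Measure C2 := surfaceMeasure (egg p)

/-- The Monge–Ampère boundary measure `ωₚ` on `b𝓔ₚ`. -/
def eggOmega (p : ℕ) : Measure C2 := mongeAmpereMeasure (egg p) (eggExhaustion p)

/-- The parametrization `ϑ(s, θ₁, θ₂) = (s^{1/2p} e^{iθ₁}, (1-s)^{1/2p} e^{iθ₂})` of
`b𝓔ₚ ∖ {z₁ z₂ = 0}`, for `(s, θ₁, θ₂) ∈ (0,1) × [0,2π)²`. -/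
def eggParam (p : ℕ) (q : ℝ × ℝ × ℝ) : C2 :=
  !₂[((q.1 ^ (1 / (2 * p : ℝ)) : ℝ) : ℂ) * Complex.exp (q.2.1 * Complex.I),
     (((1 - q.1) ^ (1 / (2 * p : ℝ)) : ℝ) : ℂ) * Complex.exp (q.2.2 * Complex.I)]

/-- The coordinates `(s, θ₁, θ₂)` of a point of `b𝓔ₚ`: `s = |z₁|^{2p}`, and `θ₁, θ₂ ∈ [0, 2π)` are
arguments of `z₁, z₂`. -/
def eggCoords (p : ℕ) (z : C2) : ℝ × ℝ × ℝ :=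
  (‖z 0‖ ^ (2 * p),
    toIcoMod Real.two_pi_pos 0 (Complex.arg (z 0)),
    toIcoMod Real.two_pi_pos 0 (Complex.arg (z 1)))

theorem toIcoMod_arg {r θ : ℝ} (hr : 0 < r) (hθ : θ ∈ Set.Ico 0 (2 * Real.pi)) :
    toIcoMod Real.two_pi_pos 0 (Complex.arg ((r : ℂ) * Complex.exp (θ * Complex.I))) = θ := by
  rw [Complex.exp_mul_I, Complex.arg_mul_cos_add_sin_mul_I_eq_toIocMod hr,
    ← self_sub_toIocDiv_zsmul, toIcoMod_sub_zsmul, toIcoMod_eq_self]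
  simpa using hθ

/-- `eggCoords` inverts the parametrization `eggParam`. -/
theorem eggCoords_eggParam {p : ℕ} (hp : 0 < p) {s θ₁ θ₂ : ℝ} (hs : s ∈ Set.Ioo (0 : ℝ) 1)
    (h₁ : θ₁ ∈ Set.Ico 0 (2 * Real.pi)) (h₂ : θ₂ ∈ Set.Ico 0 (2 * Real.pi)) :
    eggCoords p (eggParam p (s, θ₁, θ₂)) = (s, θ₁, θ₂) := by
  have hs' : 0 < 1 - s := by linarith [hs.2]
  have e : (s ^ (1 / (2 * p : ℝ))) ^ (2 * p) = s := by
    rw [← Real.rpow_natCast, ← Real.rpow_mul hs.1.le]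
    have : (1 / (2 * p : ℝ)) * ((2 * p : ℕ) : ℝ) = 1 := by
      push_cast
      field_simp
    rw [this, Real.rpow_one]
  unfold eggCoords eggParam
  refine Prod.ext ?_ (Prod.ext ?_ ?_)
  · simpa [Complex.norm_exp_ofReal_mul_I, abs_of_pos (Real.rpow_pos_of_pos hs.1 _)] using e
  · exact toIcoMod_arg (Real.rpow_pos_of_pos hs.1 _) h₁
  · exact toIcoMod_arg (Real.rpow_pos_of_pos hs' _) h₂

/-- The function `s^{j/2p} (1-s)^{ℓ/2p} e^{i(jθ₁ + ℓθ₂)}`, where `x = (j, ℓ)`. -/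
def eggTerm (p : ℕ) (x : ℕ × ℕ) (q : ℝ × ℝ × ℝ) : ℂ :=
  ((q.1 ^ ((x.1 : ℝ) / (2 * p)) * (1 - q.1) ^ ((x.2 : ℝ) / (2 * p)) : ℝ) : ℂ)
    * Complex.exp (Complex.I * (x.1 * q.2.1 + x.2 * q.2.2))

/-- `f = ∑_{j,ℓ ≥ 0} a_{j,ℓ} s^{j/2p} (1-s)^{ℓ/2p} e^{i(jθ₁ + ℓθ₂)}` on `b𝓔ₚ`, with
(unconditional) convergence of the series in `L²(ν)`. -/
def IsEggSeries (p : ℕ) (ν : Measure C2) (a : ℕ × ℕ → ℂ) (f : C2 → ℂ) : Prop :=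
  Tendsto (fun S : Finset (ℕ × ℕ) =>
      eLpNorm (fun z => f z - ∑ x ∈ S, a x * eggTerm p x (eggCoords p z)) 2 ν)
    atTop (𝓝 0)

/-- The Euler beta function `β(x, y) = ∫₀¹ s^{x-1} (1-s)^{y-1} ds`. -/
def eulerBeta (x y : ℝ) : ℝ := ∫ s in (0 : ℝ)..1, s ^ (x - 1) * (1 - s) ^ (y - 1)

/-- `∑ |a_{j,ℓ}|² β((j+1)/p, (ℓ+1)/p) < ∞`. -/
def SigmaSummable (p : ℕ) (a : ℕ × ℕ → ℂ) : Prop :=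
  Summable fun x : ℕ × ℕ =>
    ‖a x‖ ^ 2 * eulerBeta (((x.1 : ℝ) + 1) / p) (((x.2 : ℝ) + 1) / p)

/-- `∑ |a_{j,ℓ}|² β(j/p + 1, ℓ/p + 1) < ∞`. -/
def OmegaSummable (p : ℕ) (a : ℕ × ℕ → ℂ) : Prop :=
  Summable fun x : ℕ × ℕ =>
    ‖a x‖ ^ 2 * eulerBeta ((x.1 : ℝ) / p + 1) ((x.2 : ℝ) / p + 1)

end

/-! Both measures are finite, have the whole boundary as support, and are invariant under the
rotations `(z₁, z₂) ↦ (e^{iα} z₁, e^{iβ} z₂)`. Invariance makes the monomials `z₁^j z₂^ℓ` orthogonal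
in `L²`. Full support means that the generating functions are those continuous on the closed egg and
holomorphic inside, and each of them is a uniform limit of polynomials (`exists_polynomial_approx`):
dilate by `r < 1`, write the dilate as a Cauchy integral over tori, and truncate the kernel. Hence
the Hardy space is the closed span of an orthogonal family, that is, the set of sums `∑ a_{j,ℓ} z₁^j
z₂^ℓ` with `∑ |a_{j,ℓ}|² ‖z₁^j z₂^ℓ‖² < ∞` (`IsEggMeasure.hardySpace_eq`). On the boundary these
monomials are the functions `eggTerm` in the coordinates `(s, θ₁, θ₂)`.

Only summability matters, so the norms are needed only up to constants independent of `(j, ℓ)`. For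
`σ`, the image under `s = |z₁|^{2p}` is comparable to `s^{1/p-1} (1-s)^{1/p-1} ds`
(`lintegral_eggSigma_comparison`), which yields `β((j+1)/p, (ℓ+1)/p)`. This comes from a
parametrization bi-Lipschitz on short angular windows where `|z₁|^{2p} ≤ 2/3`, and from the exchange
of coordinates elsewhere. For `ωₚ`, the density with respect to `σ` is `2p |z₁ z₂|^{2(p-1)}` divided
by the length of `∇φₚ` (`dcWedgeDdc_eggExhaustion`), and that length is bounded above and below.
Passing from `σ` to `ωₚ` thus amounts to shifting both exponents by `p - 1`, which gives `β(j/p + 1,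
ℓ/p + 1)`.

Since `ωₚ ≤ 4p σ`, convergence for `σ` implies convergence for `ωₚ` with the same coefficients,
which is the inclusion; for `p = 1` also `σ ≤ ω₁`. For `p > 1` the coefficients `|a_{0,ℓ}|² =
(ℓ+1)^{-(1-1/p)}` separate the spaces: the `ωₚ`-sum is dominated by `∑ ℓ^{-(2-1/p)}`, while the
`σ`-sum dominates a harmonic series. Uniqueness of coefficients in `L²(ωₚ)` excludes any other
`σ`-expansion of the same function. -/

noncomputable section

/-! ### Monomials and the geometry of the closed egg -/

/-- The monomial `z₁^j z₂^ℓ`, where `x = (j, ℓ)`. -/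
def coordMonomial (x : ℕ × ℕ) (z : C2) : ℂ := z 0 ^ x.1 * z 1 ^ x.2

/-- The defining function `|z₁|^{2p} + |z₂|^{2p}` of the egg domain. -/
def eggRho (p : ℕ) (z : C2) : ℝ := ‖z 0‖ ^ (2 * p) + ‖z 1‖ ^ (2 * p)

theorem continuous_coordMonomial (x : ℕ × ℕ) : Continuous (coordMonomial x) := by
  unfold coordMonomial; fun_prop

theorem differentiable_coordMonomial (x : ℕ × ℕ) : Differentiable ℂ (coordMonomial x) := by
  unfold coordMonomial; fun_prop

theorem continuous_eggRho (p : ℕ) : Continuous (eggRho p) := by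
  unfold eggRho; fun_prop

theorem isOpen_egg (p : ℕ) : IsOpen (egg p) :=
  isOpen_lt (continuous_eggRho p) continuous_const

theorem eggRho_smul (p : ℕ) (c : ℂ) (z : C2) :
    eggRho p (c • z) = ‖c‖ ^ (2 * p) * eggRho p z := by
  simp [eggRho, mul_pow, mul_add]

theorem frontier_egg {p : ℕ} (hp : 0 < p) : frontier (egg p) = {z | eggRho p z = 1} := by
  apply Set.Subset.antisymm
  · exact frontier_lt_subset_eq (continuous_eggRho p) continuous_const
  · intro z hz
    rw [Set.mem_ofPred_eq] at hz
    rw [frontier, (isOpen_egg p).interior_eq]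
    refine ⟨?_, fun h => ?_⟩
    -- By homogeneity of `eggRho`, the points `t z` with `0 < t < 1` lie in the egg and tend to `z`.
    · have hl : Tendsto (fun t : ℝ => ((t : ℂ)) • z) (𝓝[<] 1) (𝓝 z) := by
        have : Tendsto (fun t : ℝ => ((t : ℂ)) • z) (𝓝 1) (𝓝 (((1 : ℝ) : ℂ) • z)) :=
          Continuous.tendsto (by fun_prop) 1
        simpa using this.mono_left nhdsWithin_le_nhds
      refine mem_closure_of_tendsto hl ?_
      have h0 : Set.Ioo (0 : ℝ) 1 ∈ 𝓝[<] (1 : ℝ) := Ioo_mem_nhdsLT one_pos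
      filter_upwards [h0] with t ht
      change eggRho p _ < 1
      rw [eggRho_smul, hz, mul_one, Complex.norm_real, Real.norm_of_nonneg ht.1.le]
      exact pow_lt_one₀ ht.1.le ht.2 (by omega)
    · have : eggRho p z < 1 := h
      linarith

theorem egg_union_frontier {p : ℕ} (hp : 0 < p) :
    egg p ∪ frontier (egg p) = {z | eggRho p z ≤ 1} := by
  rw [frontier_egg hp]
  ext z
  simp only [Set.mem_union, Set.mem_ofPred_eq, le_iff_lt_or_eq]
  rfl

theorem norm_le_one_of_eggRho_le {p : ℕ} (hp : 0 < p) {z : C2} (hz : eggRho p z ≤ 1) (i : Fin 2) :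
    ‖z i‖ ≤ 1 := by
  have h : ‖z i‖ ^ (2 * p) ≤ 1 := by
    unfold eggRho at hz
    have h0 : 0 ≤ ‖z 0‖ ^ (2 * p) := by positivity
    have h1 : 0 ≤ ‖z 1‖ ^ (2 * p) := by positivity
    fin_cases i <;> simp <;> linarith
  exact (pow_le_one_iff_of_nonneg (norm_nonneg _) (by omega)).1 h

theorem isCompact_eggRho_le {p : ℕ} (hp : 0 < p) : IsCompact {z : C2 | eggRho p z ≤ 1} := by
  refine Metric.isCompact_of_isClosed_isBounded
    (isClosed_le (continuous_eggRho p) continuous_const) ?_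
  refine (Metric.isBounded_closedBall (x := (0 : C2)) (r := 2)).subset fun z hz => ?_
  rw [mem_closedBall_zero_iff, EuclideanSpace.norm_eq, Real.sqrt_le_left (by norm_num),
    Fin.sum_univ_two]
  have h0 := norm_le_one_of_eggRho_le hp hz 0
  have h1 := norm_le_one_of_eggRho_le hp hz 1
  have := norm_nonneg (z 0)
  have := norm_nonneg (z 1)
  nlinarith

/-- The argument is defined only modulo `2π`, which the integer exponent `j` does not see. -/
theorem rpow_mul_exp_toIcoMod_arg {p : ℕ} (hp : 0 < p) (w : ℂ) (j : ℕ) :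
    (((‖w‖ ^ (2 * p)) ^ ((j : ℝ) / (2 * p)) : ℝ) : ℂ) *
      Complex.exp (Complex.I * (j * (toIcoMod Real.two_pi_pos 0 (Complex.arg w) : ℝ))) =
      w ^ j := by
  have hp' : (0 : ℝ) < p := by exact_mod_cast hp
  have h1 : (‖w‖ ^ (2 * p)) ^ ((j : ℝ) / (2 * p)) = ‖w‖ ^ j := by
    rw [← Real.rpow_natCast ‖w‖ (2 * p), ← Real.rpow_mul (norm_nonneg _), ← Real.rpow_natCast]
    congr 1
    push_cast
    field_simp
  have h2 : Complex.exp (Complex.I * (j * (toIcoMod Real.two_pi_pos 0 (Complex.arg w) : ℝ))) =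
      Complex.exp (Complex.arg w * Complex.I) ^ j := by
    rw [← Complex.exp_nat_mul, ← self_sub_toIcoDiv_zsmul, Complex.exp_eq_exp_iff_exists_int]
    refine ⟨-(j * toIcoDiv Real.two_pi_pos 0 (Complex.arg w)), ?_⟩
    simp only [zsmul_eq_mul]
    push_cast
    ring
  rw [h1, h2]
  push_cast
  rw [← mul_pow, Complex.norm_mul_exp_arg_mul_I]

/-- Translates the series of the theorem into power series. It also holds where a coordinate
vanishes, because `0 ^ 0 = 1` on both sides, so no null set is removed. -/
theorem eggTerm_eggCoords {p : ℕ} (hp : 0 < p) {z : C2} (hz : z ∈ frontier (egg p)) (x : ℕ × ℕ) :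
    eggTerm p x (eggCoords p z) = coordMonomial x z := by
  rw [frontier_egg hp] at hz
  have hz' : 1 - ‖z 0‖ ^ (2 * p) = ‖z 1‖ ^ (2 * p) := by
    have : ‖z 0‖ ^ (2 * p) + ‖z 1‖ ^ (2 * p) = 1 := hz
    linarith
  unfold eggTerm eggCoords coordMonomial
  rw [← rpow_mul_exp_toIcoMod_arg hp (z 0) x.1, ← rpow_mul_exp_toIcoMod_arg hp (z 1) x.2]
  simp only [hz', mul_add, Complex.exp_add]
  push_cast
  ring

end

/-! ### Uniform approximation by polynomials via Cauchy integrals on tori -/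

noncomputable section

/-- The point `e^{iθ}` of the unit circle. -/
def unitCirc (θ : ℝ) : ℂ := Complex.exp (θ * Complex.I)

theorem norm_unitCirc (θ : ℝ) : ‖unitCirc θ‖ = 1 := Complex.norm_exp_ofReal_mul_I θ

theorem unitCirc_ne_zero (θ : ℝ) : unitCirc θ ≠ 0 := Complex.exp_ne_zero _

theorem continuous_unitCirc : Continuous unitCirc := by unfold unitCirc; fun_prop

theorem circleMap_zero_one (θ : ℝ) : circleMap 0 1 θ = unitCirc θ := by
  simp [circleMap, unitCirc]

/-- Lebesgue measure on a period of the angle. -/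
def angleMeasure : Measure ℝ := volume.restrict (Set.Ioc 0 (2 * Real.pi))

instance : IsFiniteMeasure angleMeasure := by unfold angleMeasure; infer_instance

theorem angleMeasure_real_univ : angleMeasure.real Set.univ = 2 * Real.pi := by
  simp [angleMeasure, Real.pi_pos.le]

theorem circleIntegral_eq_angle (f : ℂ → ℂ) :
    (∮ w in C(0, 1), f w) =
      Complex.I * ∫ θ, unitCirc θ * f (unitCirc θ) ∂angleMeasure := by
  rw [circleIntegral, intervalIntegral.integral_of_le Real.two_pi_pos.le, ← integral_const_mul]
  refine integral_congr_ae (Eventually.of_forall fun θ => ?_)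
  simp only [deriv_circleMap, circleMap_zero_one, smul_eq_mul]
  ring

theorem iteratedDeriv_comp_mul_left_apply (k : ℂ → ℂ) (a : ℂ) (n : ℕ) :
    iteratedDeriv n (fun w => k (a * w)) = fun w => a ^ n * iteratedDeriv n k (a * w) := by
  induction n with
  | zero => simp
  | succ n ih =>
    rw [iteratedDeriv_succ, ih]
    funext w
    rw [deriv_const_mul_field', iteratedDeriv_succ]
    simp only [deriv_comp_mul_left, smul_eq_mul]
    ring

/-- Cauchy's formula for the `n`-th derivative at the centre. The point is the form of the right
side: the radius `a` enters only through `a ^ n`. -/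
theorem integral_angle_coeff {k : ℂ → ℂ} {a : ℂ}
    (hk : DiffContOnCl ℂ (fun w => k (a * w)) (Metric.ball 0 1)) (n : ℕ) :
    ∫ θ, (unitCirc θ)⁻¹ ^ n * k (a * unitCirc θ) ∂angleMeasure =
      a ^ n * (2 * Real.pi / n.factorial * iteratedDeriv n k 0) := by
  have h := hk.circleIntegral_one_div_sub_center_pow_smul one_pos n
  rw [circleIntegral_eq_angle, iteratedDeriv_comp_mul_left_apply] at h
  have h2 : ∫ θ, (unitCirc θ)⁻¹ ^ n * k (a * unitCirc θ) ∂angleMeasure =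
      ∫ θ, unitCirc θ * ((1 / (unitCirc θ - 0) ^ (n + 1)) • k (a * unitCirc θ)) ∂angleMeasure := by
    refine integral_congr_ae (Eventually.of_forall fun θ => ?_)
    have := unitCirc_ne_zero θ
    simp only [sub_zero, smul_eq_mul, inv_pow]
    field_simp
    ring
  rw [h2]
  apply mul_left_cancel₀ Complex.I_ne_zero
  rw [h]
  simp only [mul_zero, smul_eq_mul]
  ring

/-- On the unit circle `(1 - r/ζ)⁻¹ = ζ/(ζ - r)`, so this is Cauchy's formula at the interior point
`r`. The kernel is kept in the form that expands as a geometric series. -/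
theorem integral_angle_cauchy {k : ℂ → ℂ} {a : ℂ}
    (hk : DiffContOnCl ℂ (fun w => k (a * w)) (Metric.ball 0 1)) {r : ℝ} (h0 : 0 ≤ r)
    (hr : r < 1) :
    ∫ θ, (1 - r * (unitCirc θ)⁻¹)⁻¹ * k (a * unitCirc θ) ∂angleMeasure =
      2 * Real.pi * k (a * r) := by
  have hw : (r : ℂ) ∈ Metric.ball (0 : ℂ) 1 := by
    simpa [abs_of_nonneg h0] using hr
  have h := hk.circleIntegral_sub_inv_smul hw
  rw [circleIntegral_eq_angle] at h
  have h2 : ∫ θ, (1 - r * (unitCirc θ)⁻¹)⁻¹ * k (a * unitCirc θ) ∂angleMeasure =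
      ∫ θ, unitCirc θ * ((unitCirc θ - r)⁻¹ • k (a * unitCirc θ)) ∂angleMeasure := by
    refine integral_congr_ae (Eventually.of_forall fun θ => ?_)
    have h1 := unitCirc_ne_zero θ
    have : (1 - r * (unitCirc θ)⁻¹) = (unitCirc θ)⁻¹ * (unitCirc θ - r) := by
      field_simp
    simp only [this, mul_inv, inv_inv, smul_eq_mul]
    ring
  rw [h2]
  apply mul_left_cancel₀ Complex.I_ne_zero
  rw [h]
  simp only [smul_eq_mul]
  ring

section Egg

variable {p : ℕ} {F : C2 → ℂ}

theorem eggRho_pair (p : ℕ) (a b : ℂ) : eggRho p !₂[a, b] = ‖a‖ ^ (2 * p) + ‖b‖ ^ (2 * p) := by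
  simp [eggRho]

theorem eggRho_pair_le {a b a' b' : ℂ} (h : eggRho p !₂[a, b] ≤ 1) (ha : ‖a'‖ ≤ ‖a‖)
    (hb : ‖b'‖ ≤ ‖b‖) : eggRho p !₂[a', b'] ≤ 1 := by
  rw [eggRho_pair] at *
  have := pow_le_pow_left₀ (norm_nonneg _) ha (2 * p)
  have := pow_le_pow_left₀ (norm_nonneg _) hb (2 * p)
  linarith

theorem diffContOnCl_slice_fst (hp : 0 < p) (hd : DifferentiableOn ℂ F (egg p))
    (hc : ContinuousOn F {z | eggRho p z ≤ 1}) {a b : ℂ} (h : eggRho p !₂[a, b] ≤ 1) :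
    DiffContOnCl ℂ (fun w => F !₂[a * w, b]) (Metric.ball 0 1) := by
  -- For `a = 0` the slice may lie in the boundary, where `F` need not be differentiable, but then
  -- it is constant. For `a ≠ 0` the open disc is mapped into the open egg.
  rcases eq_or_ne a 0 with rfl | ha
  · simpa using diffContOnCl_const
  refine ⟨?_, ?_⟩
  · refine hd.comp (f := fun w : ℂ => (!₂[a * w, b] : C2)) ?_ ?_
    · refine Differentiable.differentiableOn ?_
      rw [differentiable_euclidean]
      intro i
      fin_cases i
      · simpa using differentiable_id.const_mul a
      · simp
    · intro w hw
      change eggRho p _ < 1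
      rw [mem_ball_zero_iff] at hw
      rw [eggRho_pair] at *
      refine lt_of_lt_of_le ?_ h
      have : ‖a * w‖ < ‖a‖ := by
        rw [norm_mul]
        exact mul_lt_of_lt_one_right (norm_pos_iff.2 ha) hw
      have := pow_lt_pow_left₀ this (norm_nonneg _) (n := 2 * p) (by omega)
      linarith
  · rw [closure_ball _ one_ne_zero]
    refine hc.comp (f := fun w : ℂ => (!₂[a * w, b] : C2)) ?_ ?_
    · fun_prop
    · intro w hw
      rw [mem_closedBall_zero_iff] at hw
      refine eggRho_pair_le h ?_ le_rfl
      rw [norm_mul]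
      exact mul_le_of_le_one_right (norm_nonneg _) hw

theorem diffContOnCl_slice_snd (hp : 0 < p) (hd : DifferentiableOn ℂ F (egg p))
    (hc : ContinuousOn F {z | eggRho p z ≤ 1}) {a b : ℂ} (h : eggRho p !₂[a, b] ≤ 1) :
    DiffContOnCl ℂ (fun w => F !₂[a, b * w]) (Metric.ball 0 1) := by
  rcases eq_or_ne b 0 with rfl | hb
  · simpa using diffContOnCl_const
  refine ⟨?_, ?_⟩
  · refine hd.comp (f := fun w : ℂ => (!₂[a, b * w] : C2)) ?_ ?_
    · refine Differentiable.differentiableOn ?_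
      rw [differentiable_euclidean]
      intro i
      fin_cases i
      · simp
      · simpa using differentiable_id.const_mul b
    · intro w hw
      change eggRho p _ < 1
      rw [mem_ball_zero_iff] at hw
      rw [eggRho_pair] at *
      refine lt_of_lt_of_le ?_ h
      have : ‖b * w‖ < ‖b‖ := by
        rw [norm_mul]
        exact mul_lt_of_lt_one_right (norm_pos_iff.2 hb) hw
      have := pow_lt_pow_left₀ this (norm_nonneg _) (n := 2 * p) (by omega)
      linarith
  · rw [closure_ball _ one_ne_zero]
    refine hc.comp (f := fun w : ℂ => (!₂[a, b * w] : C2)) ?_ ?_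
    · fun_prop
    · intro w hw
      rw [mem_closedBall_zero_iff] at hw
      refine eggRho_pair_le h le_rfl ?_
      rw [norm_mul]
      exact mul_le_of_le_one_right (norm_nonneg _) hw

theorem continuous_torus_orbit (hc : ContinuousOn F {z | eggRho p z ≤ 1}) {a b : ℂ}
    (h : eggRho p !₂[a, b] ≤ 1) :
    Continuous fun θ : ℝ × ℝ => F !₂[a * unitCirc θ.1, b * unitCirc θ.2] := by
  have h1 := continuous_unitCirc
  refine hc.comp_continuous (by fun_prop) fun θ => ?_
  exact eggRho_pair_le h (by simp [norm_unitCirc]) (by simp [norm_unitCirc])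

theorem integrable_angle_prod {G : ℝ × ℝ → ℂ} (hG : Continuous G) :
    Integrable G (angleMeasure.prod angleMeasure) := by
  unfold angleMeasure
  rw [Measure.prod_restrict, ← Measure.volume_eq_prod]
  refine (hG.continuousOn.integrableOn_compact
    ((isCompact_Icc (a := (0 : ℝ)) (b := 2 * Real.pi)).prod
      (isCompact_Icc (a := (0 : ℝ)) (b := 2 * Real.pi)))).mono_set ?_
  exact Set.prod_mono Set.Ioc_subset_Icc_self Set.Ioc_subset_Icc_self

/-- The Fourier coefficient of `F` on the torus through `(a, b)`. -/
def torusCoeff (F : C2 → ℂ) (j l : ℕ) (a b : ℂ) : ℂ :=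
  ∫ θ, (unitCirc θ.1)⁻¹ ^ j * (unitCirc θ.2)⁻¹ ^ l *
    F !₂[a * unitCirc θ.1, b * unitCirc θ.2] ∂angleMeasure.prod angleMeasure

theorem continuous_torusCoeff_integrand (hc : ContinuousOn F {z | eggRho p z ≤ 1}) {a b : ℂ}
    (h : eggRho p !₂[a, b] ≤ 1) (j l : ℕ) :
    Continuous fun θ : ℝ × ℝ => (unitCirc θ.1)⁻¹ ^ j * (unitCirc θ.2)⁻¹ ^ l *
      F !₂[a * unitCirc θ.1, b * unitCirc θ.2] := by
  have h1 : Continuous fun θ => (unitCirc θ)⁻¹ := continuous_unitCirc.inv₀ unitCirc_ne_zero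
  exact (((h1.comp continuous_fst).pow j).mul ((h1.comp continuous_snd).pow l)).mul
    (continuous_torus_orbit hc h)

/-- By Fubini and Cauchy's formula in the second variable, the coefficient is `b ^ l` times a
quantity free of `b`. The cross-multiplied form allows `b` or `b'` to vanish. -/
theorem torusCoeff_mul_pow_snd (hp : 0 < p) (hd : DifferentiableOn ℂ F (egg p))
    (hc : ContinuousOn F {z | eggRho p z ≤ 1}) {a b b' : ℂ} (h : eggRho p !₂[a, b] ≤ 1)
    (h' : eggRho p !₂[a, b'] ≤ 1) (j l : ℕ) :
    torusCoeff F j l a b * b' ^ l = b ^ l * torusCoeff F j l a b' := by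
  have key : ∀ b : ℂ, eggRho p !₂[a, b] ≤ 1 → torusCoeff F j l a b =
      b ^ l * ∫ θ, (unitCirc θ)⁻¹ ^ j * (2 * Real.pi / l.factorial *
        iteratedDeriv l (fun w => F !₂[a * unitCirc θ, w]) 0) ∂angleMeasure := by
    intro b h
    rw [torusCoeff, integral_prod _ (integrable_angle_prod (continuous_torusCoeff_integrand hc h _ _)),
      ← integral_const_mul]
    refine integral_congr_ae (Eventually.of_forall fun θ => ?_)
    have hs := diffContOnCl_slice_snd hp hd hc (a := a * unitCirc θ)
      (eggRho_pair_le (b' := b) h (by simp [norm_unitCirc]) le_rfl)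
    have := integral_angle_coeff (k := fun w => F !₂[a * unitCirc θ, w]) hs l
    simp only [mul_assoc, integral_const_mul]
    rw [this]
    ring
  rw [key b h, key b' h']
  ring

theorem torusCoeff_mul_pow_fst (hp : 0 < p) (hd : DifferentiableOn ℂ F (egg p))
    (hc : ContinuousOn F {z | eggRho p z ≤ 1}) {a a' b : ℂ} (h : eggRho p !₂[a, b] ≤ 1)
    (h' : eggRho p !₂[a', b] ≤ 1) (j l : ℕ) :
    torusCoeff F j l a b * a' ^ j = a ^ j * torusCoeff F j l a' b := by
  have key : ∀ a : ℂ, eggRho p !₂[a, b] ≤ 1 → torusCoeff F j l a b =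
      a ^ j * ∫ θ, (unitCirc θ)⁻¹ ^ l * (2 * Real.pi / j.factorial *
        iteratedDeriv j (fun w => F !₂[w, b * unitCirc θ]) 0) ∂angleMeasure := by
    intro a h
    rw [torusCoeff,
      integral_prod_symm _ (integrable_angle_prod (continuous_torusCoeff_integrand hc h _ _)),
      ← integral_const_mul]
    refine integral_congr_ae (Eventually.of_forall fun θ => ?_)
    have hs := diffContOnCl_slice_fst hp hd hc (b := b * unitCirc θ)
      (eggRho_pair_le (a' := a) h le_rfl (by simp [norm_unitCirc]))
    have := integral_angle_coeff (k := fun w => F !₂[w, b * unitCirc θ]) hs j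
    simp only [mul_comm ((unitCirc _)⁻¹ ^ j) ((unitCirc _)⁻¹ ^ l), mul_assoc, integral_const_mul]
    rw [this]
    ring
  rw [key a h, key a' h']
  ring

/-- The Fourier coefficients on all tori of the closed egg come from one power series, normalized
here on the torus of radii `(1/2, 1/2)`. The coordinates are moved to `1/2` one at a time. -/
theorem torusCoeff_eq (hp : 0 < p) (hd : DifferentiableOn ℂ F (egg p))
    (hc : ContinuousOn F {z | eggRho p z ≤ 1}) {a b : ℂ} (h : eggRho p !₂[a, b] ≤ 1) (j l : ℕ) :
    torusCoeff F j l a b = a ^ j * b ^ l * (2 ^ (j + l) * torusCoeff F j l (1 / 2) (1 / 2)) := by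
  have hδ : ‖(1 / 2 : ℂ)‖ ^ (2 * p) ≤ 1 / 2 := by
    have : ‖(1 / 2 : ℂ)‖ = 1 / 2 := by simp
    rw [this]
    calc (1 / 2 : ℝ) ^ (2 * p) ≤ (1 / 2) ^ 1 :=
          pow_le_pow_of_le_one (by norm_num) (by norm_num) (by omega)
      _ = 1 / 2 := by norm_num
  have h22 : eggRho p !₂[(1 / 2 : ℂ), 1 / 2] ≤ 1 := by rw [eggRho_pair]; linarith
  have h3 : torusCoeff F j l a b * (1 / 2) ^ j * (1 / 2) ^ l =
      a ^ j * b ^ l * torusCoeff F j l (1 / 2) (1 / 2) := by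
    have h' := h
    rw [eggRho_pair] at h'
    -- The intermediate point must stay in the closed egg. The smaller of the two powers is at most
    -- `1/2`, and so is `(1/2)^{2p}`; hence the larger coordinate is replaced by `1/2` first.
    rcases le_total (‖a‖ ^ (2 * p)) (‖b‖ ^ (2 * p)) with hab | hab
    · have ha2 : eggRho p !₂[a, (1 / 2 : ℂ)] ≤ 1 := by rw [eggRho_pair]; linarith
      have e1 := torusCoeff_mul_pow_snd hp hd hc h ha2 j l
      have e2 := torusCoeff_mul_pow_fst hp hd hc ha2 h22 j l
      linear_combination (1 / 2) ^ j * e1 + b ^ l * e2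
    · have hb2 : eggRho p !₂[(1 / 2 : ℂ), b] ≤ 1 := by rw [eggRho_pair]; linarith
      have e1 := torusCoeff_mul_pow_fst hp hd hc h hb2 j l
      have e2 := torusCoeff_mul_pow_snd hp hd hc hb2 h22 j l
      linear_combination (1 / 2) ^ l * e1 + a ^ j * e2
  have h4 : (2 : ℂ) ^ (j + l) * ((1 / 2) ^ j * (1 / 2) ^ l) = 1 := by
    rw [← pow_add, ← mul_pow]; norm_num
  linear_combination 2 ^ (j + l) * h3 - torusCoeff F j l a b * h4

theorem integral_torus_cauchy (hp : 0 < p) (hd : DifferentiableOn ℂ F (egg p))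
    (hc : ContinuousOn F {z | eggRho p z ≤ 1}) {a b : ℂ} (h : eggRho p !₂[a, b] ≤ 1)
    {r : ℝ} (h0 : 0 ≤ r) (hr : r < 1) :
    ∫ θ, (1 - r * (unitCirc θ.1)⁻¹)⁻¹ * (1 - r * (unitCirc θ.2)⁻¹)⁻¹ *
      F !₂[a * unitCirc θ.1, b * unitCirc θ.2] ∂angleMeasure.prod angleMeasure =
      (2 * Real.pi) ^ 2 * F !₂[a * r, b * r] := by
  have hne : ∀ θ, (1 - r * (unitCirc θ)⁻¹) ≠ 0 := fun θ he => by
    have : ‖(r : ℂ) * (unitCirc θ)⁻¹‖ = 1 := by rw [← sub_eq_zero.1 he]; simp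
    rw [norm_mul, norm_inv, norm_unitCirc, Complex.norm_real, Real.norm_of_nonneg h0] at this
    linarith
  have h1 : Continuous fun θ => (1 - r * (unitCirc θ)⁻¹)⁻¹ :=
    (continuous_const.sub (continuous_const.mul
      (continuous_unitCirc.inv₀ unitCirc_ne_zero))).inv₀ hne
  have h2 : Continuous fun θ : ℝ × ℝ => (1 - r * (unitCirc θ.1)⁻¹)⁻¹ *
      (1 - r * (unitCirc θ.2)⁻¹)⁻¹ * F !₂[a * unitCirc θ.1, b * unitCirc θ.2] :=
    ((h1.comp continuous_fst).mul (h1.comp continuous_snd)).mul (continuous_torus_orbit hc h)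
  rw [integral_prod _ (integrable_angle_prod h2)]
  have hin : ∀ θ, ∫ θ', (1 - r * (unitCirc θ)⁻¹)⁻¹ * (1 - r * (unitCirc θ')⁻¹)⁻¹ *
      F !₂[a * unitCirc θ, b * unitCirc θ'] ∂angleMeasure =
      (2 * Real.pi) * ((1 - r * (unitCirc θ)⁻¹)⁻¹ * F !₂[a * unitCirc θ, b * r]) := by
    intro θ
    have hs := diffContOnCl_slice_snd hp hd hc (a := a * unitCirc θ)
      (eggRho_pair_le (b' := b) h (by simp [norm_unitCirc]) le_rfl)
    have := integral_angle_cauchy (k := fun w => F !₂[a * unitCirc θ, w]) hs h0 hr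
    simp only [mul_assoc, integral_const_mul]
    rw [this]
    ring
  simp only [hin, integral_const_mul]
  have hs := diffContOnCl_slice_fst hp hd hc (b := b * r)
      (eggRho_pair_le (a' := a) h le_rfl (by
        rw [norm_mul, Complex.norm_real, Real.norm_of_nonneg h0]
        exact mul_le_of_le_one_right (norm_nonneg _) hr.le))
  rw [integral_angle_cauchy (k := fun w => F !₂[w, b * r]) hs h0 hr]
  ring

/-- The remainder of the truncated double geometric series is `(1 - q₁)⁻¹ (1 - q₂)⁻¹ (q₁^N + q₂^N -
q₁^N q₂^N)`. -/
theorem norm_geom_kernel_sub_le {q₁ q₂ : ℂ} {r : ℝ} (hr : r < 1) (h₁ : ‖q₁‖ = r) (h₂ : ‖q₂‖ = r)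
    (N : ℕ) :
    ‖(1 - q₁)⁻¹ * (1 - q₂)⁻¹ - (∑ n ∈ Finset.range N, q₁ ^ n) * ∑ n ∈ Finset.range N, q₂ ^ n‖ ≤
      3 / (1 - r) ^ 2 * r ^ N := by
  have h0 : 0 ≤ r := h₁ ▸ norm_nonneg _
  have hinv : ∀ q : ℂ, ‖q‖ = r → 1 - q ≠ 0 ∧ ‖(1 - q)⁻¹‖ ≤ (1 - r)⁻¹ ∧
      ∑ n ∈ Finset.range N, q ^ n = (1 - q)⁻¹ - q ^ N * (1 - q)⁻¹ := by
    intro q hq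
    have h1 : 1 - r ≤ ‖1 - q‖ := by
      have := norm_sub_norm_le (1 : ℂ) q
      simpa [hq] using this
    have hne : 1 - q ≠ 0 := norm_pos_iff.1 (by linarith)
    refine ⟨hne, ?_, ?_⟩
    · rw [norm_inv]
      exact inv_anti₀ (by linarith) h1
    · have hq1 : q ≠ 1 := fun h => hne (by simp [h])
      rw [geom_sum_eq hq1]
      have : q - 1 ≠ 0 := sub_ne_zero.2 hq1
      field_simp
      ring
  obtain ⟨-, b₁, e₁⟩ := hinv q₁ h₁
  obtain ⟨-, b₂, e₂⟩ := hinv q₂ h₂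
  rw [e₁, e₂]
  have e : (1 - q₁)⁻¹ * (1 - q₂)⁻¹ -
      ((1 - q₁)⁻¹ - q₁ ^ N * (1 - q₁)⁻¹) * ((1 - q₂)⁻¹ - q₂ ^ N * (1 - q₂)⁻¹) =
      ((1 - q₁)⁻¹ * (1 - q₂)⁻¹) * (q₁ ^ N + q₂ ^ N - q₁ ^ N * q₂ ^ N) := by ring
  rw [e, norm_mul, norm_mul]
  have hN : r ^ N ≤ 1 := pow_le_one₀ h0 hr.le
  have hN0 : 0 ≤ r ^ N := pow_nonneg h0 N
  have h3 : ‖q₁ ^ N + q₂ ^ N - q₁ ^ N * q₂ ^ N‖ ≤ 3 * r ^ N := by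
    calc _ ≤ ‖q₁ ^ N + q₂ ^ N‖ + ‖q₁ ^ N * q₂ ^ N‖ := norm_sub_le _ _
      _ ≤ ‖q₁ ^ N‖ + ‖q₂ ^ N‖ + ‖q₁ ^ N * q₂ ^ N‖ := by gcongr; exact norm_add_le _ _
      _ = r ^ N + r ^ N + r ^ N * r ^ N := by simp [h₁, h₂]
      _ ≤ 3 * r ^ N := by nlinarith
  have h1r : 0 < 1 - r := by linarith
  calc ‖(1 - q₁)⁻¹‖ * ‖(1 - q₂)⁻¹‖ * ‖q₁ ^ N + q₂ ^ N - q₁ ^ N * q₂ ^ N‖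
      ≤ (1 - r)⁻¹ * (1 - r)⁻¹ * (3 * r ^ N) := by gcongr
    _ = 3 / (1 - r) ^ 2 * r ^ N := by field_simp

theorem pair_eta (z : C2) : !₂[z 0, z 1] = z := by
  ext i; fin_cases i <;> rfl

/-- Integrating `F` against the full kernel gives the dilate, against the truncated kernel a
polynomial. The kernel error does not depend on `z`, so the estimate is uniform up to the boundary.
-/
theorem norm_dilation_sub_sum_le (hp : 0 < p) (hd : DifferentiableOn ℂ F (egg p))
    (hc : ContinuousOn F {z | eggRho p z ≤ 1}) {M : ℝ} (hM : ∀ z, eggRho p z ≤ 1 → ‖F z‖ ≤ M)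
    {r : ℝ} (h0 : 0 ≤ r) (hr : r < 1) (N : ℕ) {z : C2} (hz : eggRho p z ≤ 1) :
    ‖F ((r : ℂ) • z) - ∑ x ∈ Finset.range N ×ˢ Finset.range N,
      (((2 * Real.pi : ℂ) ^ 2)⁻¹ * (r ^ x.1 * r ^ x.2) *
        (2 ^ (x.1 + x.2) * torusCoeff F x.1 x.2 (1 / 2) (1 / 2))) * coordMonomial x z‖ ≤
      3 / (1 - r) ^ 2 * r ^ N * M := by
  set a := z 0
  set b := z 1
  have hab : eggRho p !₂[a, b] ≤ 1 := by rwa [pair_eta]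
  have hFr : F ((r : ℂ) • z) = F !₂[a * r, b * r] := by
    congr 1
    ext i; fin_cases i <;> simp [a, b, mul_comm]
  have hpi : ((2 * Real.pi : ℂ) ^ 2) ≠ 0 := by
    simp [Real.pi_ne_zero]
  set τ := angleMeasure.prod angleMeasure
  have hinv : Continuous fun θ => (unitCirc θ)⁻¹ := continuous_unitCirc.inv₀ unitCirc_ne_zero
  have hq : ∀ θ, ‖(r : ℂ) * (unitCirc θ)⁻¹‖ = r := fun θ => by
    rw [norm_mul, norm_inv, norm_unitCirc, Complex.norm_real, Real.norm_of_nonneg h0]; simp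
  have hne : ∀ θ, (1 - r * (unitCirc θ)⁻¹) ≠ 0 := fun θ he => by
    have := hq θ
    rw [← sub_eq_zero.1 he] at this
    simp at this
    linarith
  have h1 : Continuous fun θ => (1 - r * (unitCirc θ)⁻¹)⁻¹ :=
    (continuous_const.sub (continuous_const.mul hinv)).inv₀ hne
  have hsum : ∑ x ∈ Finset.range N ×ˢ Finset.range N,
      (((2 * Real.pi : ℂ) ^ 2)⁻¹ * (r ^ x.1 * r ^ x.2) *
        (2 ^ (x.1 + x.2) * torusCoeff F x.1 x.2 (1 / 2) (1 / 2))) * coordMonomial x z =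
      ((2 * Real.pi : ℂ) ^ 2)⁻¹ * ∫ θ, (∑ n ∈ Finset.range N, (r * (unitCirc θ.1)⁻¹) ^ n) *
        (∑ n ∈ Finset.range N, (r * (unitCirc θ.2)⁻¹) ^ n) *
          F !₂[a * unitCirc θ.1, b * unitCirc θ.2] ∂τ := by
    have : ∀ θ : ℝ × ℝ, (∑ n ∈ Finset.range N, (r * (unitCirc θ.1)⁻¹) ^ n) *
        (∑ n ∈ Finset.range N, (r * (unitCirc θ.2)⁻¹) ^ n) *
          F !₂[a * unitCirc θ.1, b * unitCirc θ.2] =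
        ∑ x ∈ Finset.range N ×ˢ Finset.range N, (r ^ x.1 * r ^ x.2) *
          ((unitCirc θ.1)⁻¹ ^ x.1 * (unitCirc θ.2)⁻¹ ^ x.2 *
            F !₂[a * unitCirc θ.1, b * unitCirc θ.2]) := by
      intro θ
      rw [Finset.sum_mul_sum, ← Finset.sum_product', Finset.sum_mul]
      refine Finset.sum_congr rfl fun x _ => ?_
      rw [mul_pow, mul_pow]
      ring
    simp only [this]
    rw [integral_finsetSum _ fun x _ => (integrable_angle_prod
      (continuous_torusCoeff_integrand hc hab _ _)).const_mul _, Finset.mul_sum]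
    refine Finset.sum_congr rfl fun x _ => ?_
    rw [integral_const_mul]
    change _ = _ * (_ * torusCoeff F x.1 x.2 a b)
    rw [torusCoeff_eq hp hd hc hab, coordMonomial]
    ring
  have hcau := integral_torus_cauchy hp hd hc hab h0 hr
  have hF : F !₂[a * r, b * r] = ((2 * Real.pi : ℂ) ^ 2)⁻¹ *
      ∫ θ, (1 - r * (unitCirc θ.1)⁻¹)⁻¹ * (1 - r * (unitCirc θ.2)⁻¹)⁻¹ *
        F !₂[a * unitCirc θ.1, b * unitCirc θ.2] ∂τ := by
    rw [hcau]; field_simp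
  have hgeo : Continuous fun θ => ∑ n ∈ Finset.range N, ((r : ℂ) * (unitCirc θ)⁻¹) ^ n :=
    continuous_finsetSum _ fun n _ => (continuous_const.mul hinv).pow n
  have horb := continuous_torus_orbit hc hab
  have hi1 : Continuous fun θ : ℝ × ℝ => (1 - r * (unitCirc θ.1)⁻¹)⁻¹ *
      (1 - r * (unitCirc θ.2)⁻¹)⁻¹ * F !₂[a * unitCirc θ.1, b * unitCirc θ.2] :=
    ((h1.comp continuous_fst).mul (h1.comp continuous_snd)).mul horb
  have hi2 : Continuous fun θ : ℝ × ℝ => (∑ n ∈ Finset.range N, (r * (unitCirc θ.1)⁻¹) ^ n) *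
        (∑ n ∈ Finset.range N, (r * (unitCirc θ.2)⁻¹) ^ n) *
          F !₂[a * unitCirc θ.1, b * unitCirc θ.2] :=
    ((hgeo.comp continuous_fst).mul (hgeo.comp continuous_snd)).mul horb
  rw [hFr, hF, hsum, ← mul_sub, ← integral_sub (integrable_angle_prod hi1)
    (integrable_angle_prod hi2)]
  have hτ : τ.real Set.univ = (2 * Real.pi) ^ 2 := by
    simp only [τ, Measure.real, ← Set.univ_prod_univ, Measure.prod_prod, ENNReal.toReal_mul]
    rw [← Measure.real, angleMeasure_real_univ]
    ring
  have hbound := norm_integral_le_of_norm_le_const (μ := τ)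
    (f := fun θ : ℝ × ℝ => (1 - r * (unitCirc θ.1)⁻¹)⁻¹ * (1 - r * (unitCirc θ.2)⁻¹)⁻¹ *
        F !₂[a * unitCirc θ.1, b * unitCirc θ.2] -
        (∑ n ∈ Finset.range N, (r * (unitCirc θ.1)⁻¹) ^ n) *
        (∑ n ∈ Finset.range N, (r * (unitCirc θ.2)⁻¹) ^ n) *
          F !₂[a * unitCirc θ.1, b * unitCirc θ.2])
    (C := 3 / (1 - r) ^ 2 * r ^ N * M) (Eventually.of_forall fun θ => by
      rw [← sub_mul, norm_mul]
      have hk := norm_geom_kernel_sub_le hr (hq θ.1) (hq θ.2) N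
      have hm := hM !₂[a * unitCirc θ.1, b * unitCirc θ.2]
        (eggRho_pair_le hab (by simp [norm_unitCirc]) (by simp [norm_unitCirc]))
      have : 0 ≤ 3 / (1 - r) ^ 2 * r ^ N := by positivity
      gcongr)
  rw [norm_mul, norm_inv]
  have hnorm : ‖((2 * Real.pi : ℂ) ^ 2)‖ = (2 * Real.pi) ^ 2 := by
    rw [norm_pow]; simp [Real.pi_pos.le]
  rw [hτ] at hbound
  rw [hnorm, inv_mul_le_iff₀ (by positivity), mul_comm ((2 * Real.pi) ^ 2)]
  exact hbound

/-- A function continuous on the closed egg and holomorphic inside is a uniform limit of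
polynomials. -/
theorem exists_polynomial_approx (hp : 0 < p) (hd : DifferentiableOn ℂ F (egg p))
    (hc : ContinuousOn F {z | eggRho p z ≤ 1}) {ε : ℝ} (hε : 0 < ε) :
    ∃ (S : Finset (ℕ × ℕ)) (c : ℕ × ℕ → ℂ), ∀ z, eggRho p z ≤ 1 →
      ‖F z - ∑ x ∈ S, c x * coordMonomial x z‖ ≤ ε := by
  have hK := isCompact_eggRho_le (p := p) hp
  obtain ⟨M, hM⟩ := hK.exists_bound_of_continuousOn hc
  have hU := hK.uniformContinuousOn_of_continuous hc
  obtain ⟨δ, hδ, hU⟩ := Metric.uniformContinuousOn_iff.1 hU (ε / 2) (by positivity)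
  obtain ⟨R, hR⟩ := hK.isBounded.exists_norm_le
  have hRpos : 0 < |R| + 1 := by positivity
  -- The radius `r` is so close to `1` that `‖z - r z‖ < δ` on the whole closed egg; `N` is chosen
  -- afterwards, in terms of this `r`.
  obtain ⟨r, h0, hr, hrδ⟩ : ∃ r : ℝ, 0 ≤ r ∧ r < 1 ∧ (1 - r) * (|R| + 1) < δ := by
    refine ⟨max 0 (1 - δ / (2 * (|R| + 1))), le_max_left _ _,
      max_lt one_pos (by linarith [show 0 < δ / (2 * (|R| + 1)) by positivity]), ?_⟩
    have h1 : 1 - max 0 (1 - δ / (2 * (|R| + 1))) ≤ δ / (2 * (|R| + 1)) := by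
      linarith [le_max_right 0 (1 - δ / (2 * (|R| + 1)))]
    calc _ ≤ δ / (2 * (|R| + 1)) * (|R| + 1) := by gcongr
      _ = δ / 2 := by field_simp
      _ < δ := by linarith
  have hlim : Tendsto (fun N : ℕ => 3 / (1 - r) ^ 2 * r ^ N * M) atTop (𝓝 0) := by
    simpa using ((tendsto_pow_atTop_nhds_zero_of_lt_one h0 hr).const_mul
      (3 / (1 - r) ^ 2)).mul_const M
  obtain ⟨N, hN⟩ := (hlim.eventually (gt_mem_nhds (half_pos hε))).exists
  refine ⟨Finset.range N ×ˢ Finset.range N, fun x =>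
    (((2 * Real.pi : ℂ) ^ 2)⁻¹ * (r ^ x.1 * r ^ x.2) *
        (2 ^ (x.1 + x.2) * torusCoeff F x.1 x.2 (1 / 2) (1 / 2))), fun z hz => ?_⟩
  have h2 := norm_dilation_sub_sum_le hp hd hc hM h0 hr N hz
  have hz' : eggRho p ((r : ℂ) • z) ≤ 1 := by
    rw [eggRho_smul, Complex.norm_real, Real.norm_of_nonneg h0]
    have : r ^ (2 * p) ≤ 1 := pow_le_one₀ h0 hr.le
    have h3 : 0 ≤ eggRho p z := by unfold eggRho; positivity
    nlinarith
  have h1 : ‖F z - F ((r : ℂ) • z)‖ ≤ ε / 2 := by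
    rw [← dist_eq_norm]
    refine (hU z hz _ hz' ?_).le
    have : z - (r : ℂ) • z = ((1 - r : ℝ) : ℂ) • z := by push_cast; rw [sub_smul, one_smul]
    rw [dist_eq_norm, this, norm_smul, Complex.norm_real, Real.norm_of_nonneg (by linarith)]
    refine lt_of_le_of_lt ?_ hrδ
    have := hR z hz
    have h4 := le_abs_self R
    have : 0 ≤ 1 - r := by linarith
    gcongr
    linarith
  calc _ = ‖(F z - F ((r : ℂ) • z)) + (F ((r : ℂ) • z) - _)‖ := by rw [sub_add_sub_cancel]
    _ ≤ _ := norm_add_le _ _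
    _ ≤ ε := by linarith

end Egg

end

/-! ### Orthogonal expansions in a Hilbert space -/

noncomputable section

section Hilbert

variable {ι E : Type*} [NormedAddCommGroup E] [InnerProductSpace ℂ E] {e : ι → E}

theorem orthonormal_normalize (horth : Pairwise fun i j => inner ℂ (e i) (e j) = 0)
    (hne : ∀ i, e i ≠ 0) : Orthonormal ℂ fun i => ((‖e i‖⁻¹ : ℝ) : ℂ) • e i := by
  refine ⟨fun i => ?_, fun i j hij => ?_⟩
  · rw [norm_smul, Complex.norm_real, norm_inv, norm_norm,
      inv_mul_cancel₀ (norm_ne_zero_iff.2 (hne i))]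
  · have h : inner ℂ (e i) (e j) = 0 := horth hij
    simp [inner_smul_left, inner_smul_right, h]

theorem summable_smul_iff_of_orthogonal [CompleteSpace E]
    (horth : Pairwise fun i j => inner ℂ (e i) (e j) = 0) (hne : ∀ i, e i ≠ 0) (a : ι → ℂ) :
    (Summable fun i => a i • e i) ↔ Summable fun i => ‖a i‖ ^ 2 * ‖e i‖ ^ 2 := by
  have hu := orthonormal_normalize horth hne
  have := hu.orthogonalFamily.summable_iff_norm_sq_summable fun i => a i * (‖e i‖ : ℂ)
  have h1 : (fun i => LinearIsometry.toSpanSingleton ℂ E (hu.1 i) (a i * (‖e i‖ : ℂ))) =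
      fun i => a i • e i := by
    funext i
    have h0 : (‖e i‖ : ℂ) ≠ 0 := by simpa using hne i
    simp only [LinearIsometry.toSpanSingleton_apply, smul_smul]
    push_cast
    rw [mul_assoc, mul_inv_cancel₀ h0, mul_one]
  simpa only [h1, norm_mul, Complex.norm_real, norm_norm, mul_pow] using this

/-- After normalization the family gives an isometry from `ℓ²` whose range is the closed span; the
image of an `ℓ²` vector is the sum of its series. -/
theorem closure_span_eq_of_orthogonal [CompleteSpace E]
    (horth : Pairwise fun i j => inner ℂ (e i) (e j) = 0) (hne : ∀ i, e i ≠ 0) :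
    closure (Submodule.span ℂ (Set.range e) : Set E) =
      {f | ∃ a : ι → ℂ, HasSum (fun i => a i • e i) f} := by
  apply Set.Subset.antisymm
  · intro f hf
    have hu := orthonormal_normalize horth hne
    have hr := hu.orthogonalFamily.range_linearIsometry
    have hle : Submodule.span ℂ (Set.range e) ≤ ⨆ i, LinearMap.range
        (LinearIsometry.toSpanSingleton ℂ E (hu.1 i)).toLinearMap := by
      rw [Submodule.span_le]
      rintro _ ⟨i, rfl⟩
      refine Submodule.mem_iSup_of_mem i ⟨(‖e i‖ : ℂ), ?_⟩
      have h0 : (‖e i‖ : ℂ) ≠ 0 := by simpa using hne i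
      simp [smul_smul, h0]
    have hf' : f ∈ LinearMap.range hu.orthogonalFamily.linearIsometry.toLinearMap := by
      rw [hr]
      exact closure_mono hle hf
    obtain ⟨w, rfl⟩ := hf'
    refine ⟨fun i => w i * ((‖e i‖⁻¹ : ℝ) : ℂ), ?_⟩
    have := hu.orthogonalFamily.hasSum_linearIsometry w
    simp only [LinearIsometry.toSpanSingleton_apply, smul_smul] at this
    exact this
  · rintro f ⟨a, ha⟩
    refine mem_closure_of_tendsto ha (Eventually.of_forall fun S => ?_)
    exact Submodule.sum_mem _ fun i _ =>
      Submodule.smul_mem _ _ (Submodule.subset_span (Set.mem_range_self i))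

/-- Pairing the sum with `e i` isolates the `i`-th coefficient. -/
theorem eq_of_hasSum_of_orthogonal (horth : Pairwise fun i j => inner ℂ (e i) (e j) = 0)
    (hne : ∀ i, e i ≠ 0) {a b : ι → ℂ} {f : E} (ha : HasSum (fun i => a i • e i) f)
    (hb : HasSum (fun i => b i • e i) f) : a = b := by
  have key : ∀ a : ι → ℂ, HasSum (fun i => a i • e i) f → ∀ i,
      inner ℂ (e i) f = a i * inner ℂ (e i) (e i) := by
    intro a ha i
    have h1 := (innerSL ℂ (e i)).hasSum ha
    have h2 : HasSum (fun j => innerSL ℂ (e i) (a j • e j)) (innerSL ℂ (e i) (a i • e i)) := by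
      refine hasSum_single i fun j hj => ?_
      simp [horth hj.symm]
    have := h1.unique h2
    simpa [inner_smul_right] using this
  funext i
  have := (key a ha i).symm.trans (key b hb i)
  exact mul_right_cancel₀ (inner_self_ne_zero.2 (hne i)) this

end Hilbert

/-- The properties of a boundary measure on the egg that determine its Hardy space. -/
structure IsEggMeasure (p : ℕ) (ν : Measure C2) : Prop where
  finite : IsFiniteMeasure ν
  support_eq : ν.support = frontier (egg p)
  orthogonal : ∀ x y : ℕ × ℕ, x ≠ y →
    ∫ z, inner ℂ (coordMonomial x z) (coordMonomial y z) ∂ν = 0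
  norm_pos : ∀ x : ℕ × ℕ, 0 < ∫ z, ‖coordMonomial x z‖ ^ 2 ∂ν

/-! ### Hardy spaces of measures with orthogonal monomials -/

namespace IsEggMeasure

variable {p : ℕ} {ν : Measure C2}

theorem ae_mem_frontier (hν : IsEggMeasure p ν) : ∀ᵐ z ∂ν, z ∈ frontier (egg p) := by
  have := Measure.support_mem_ae (μ := ν)
  rwa [hν.support_eq] at this

theorem norm_coordMonomial_le_one (hp : 0 < p) {z : C2} (hz : z ∈ frontier (egg p))
    (x : ℕ × ℕ) : ‖coordMonomial x z‖ ≤ 1 := by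
  have hz' : eggRho p z ≤ 1 := by
    rw [frontier_egg hp] at hz
    exact le_of_eq hz
  rw [coordMonomial, norm_mul, norm_pow, norm_pow]
  exact mul_le_one₀ (pow_le_one₀ (norm_nonneg _) (norm_le_one_of_eggRho_le hp hz' 0))
    (by positivity) (pow_le_one₀ (norm_nonneg _) (norm_le_one_of_eggRho_le hp hz' 1))

theorem memLp_coordMonomial (hν : IsEggMeasure p ν) (hp : 0 < p) (x : ℕ × ℕ) :
    MemLp (coordMonomial x) 2 ν := by
  have := hν.finite
  refine MemLp.of_bound (continuous_coordMonomial x).aestronglyMeasurable 1 ?_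
  filter_upwards [hν.ae_mem_frontier] with z hz
  exact norm_coordMonomial_le_one hp hz x

/-- The class of the monomial `z^x` in `L²(ν)`. -/
def basisVector (hν : IsEggMeasure p ν) (hp : 0 < p) (x : ℕ × ℕ) : Lp ℂ 2 ν :=
  (hν.memLp_coordMonomial hp x).toLp _

theorem coeFn_basisVector (hν : IsEggMeasure p ν) (hp : 0 < p) (x : ℕ × ℕ) :
    hν.basisVector hp x =ᵐ[ν] coordMonomial x := MemLp.coeFn_toLp _

theorem inner_basisVector (hν : IsEggMeasure p ν) (hp : 0 < p) (x y : ℕ × ℕ) :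
    inner ℂ (hν.basisVector hp x) (hν.basisVector hp y) =
      ∫ z, inner ℂ (coordMonomial x z) (coordMonomial y z) ∂ν := by
  rw [L2.inner_def]
  refine integral_congr_ae ?_
  filter_upwards [hν.coeFn_basisVector hp x, hν.coeFn_basisVector hp y] with z h1 h2
  rw [h1, h2]

theorem pairwise_inner_basisVector (hν : IsEggMeasure p ν) (hp : 0 < p) :
    Pairwise fun x y => inner ℂ (hν.basisVector hp x) (hν.basisVector hp y) = 0 :=
  fun x y h => (hν.inner_basisVector hp x y).trans (hν.orthogonal x y h)

theorem norm_sq_basisVector (hν : IsEggMeasure p ν) (hp : 0 < p) (x : ℕ × ℕ) :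
    ‖hν.basisVector hp x‖ ^ 2 = ∫ z, ‖coordMonomial x z‖ ^ 2 ∂ν := by
  have h := hν.inner_basisVector hp x x
  rw [inner_self_eq_norm_sq_to_K] at h
  have h2 : ∀ z, inner ℂ (coordMonomial x z) (coordMonomial x z) =
      ((‖coordMonomial x z‖ ^ 2 : ℝ) : ℂ) := fun z => by
    rw [inner_self_eq_norm_sq_to_K]; simp
  simp only [h2, integral_complex_ofReal] at h
  exact Complex.ofReal_injective (by simpa using h)

theorem basisVector_ne_zero (hν : IsEggMeasure p ν) (hp : 0 < p) (x : ℕ × ℕ) :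
    hν.basisVector hp x ≠ 0 := by
  intro h
  have h1 := hν.norm_sq_basisVector hp x
  have h2 := hν.norm_pos x
  rw [h] at h1
  simp at h1
  linarith

theorem coeFn_sum_basisVector (hν : IsEggMeasure p ν) (hp : 0 < p) (S : Finset (ℕ × ℕ))
    (a : ℕ × ℕ → ℂ) : (⇑(∑ x ∈ S, a x • hν.basisVector hp x) : C2 → ℂ) =ᵐ[ν]
      fun z => ∑ x ∈ S, a x * coordMonomial x z := by
  classical
  induction S using Finset.induction_on with
  | empty =>
    simp only [Finset.sum_empty]
    exact Lp.coeFn_zero _ _ _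
  | insert y S hy ih =>
    rw [Finset.sum_insert hy]
    filter_upwards [ih, Lp.coeFn_add (a y • hν.basisVector hp y)
      (∑ x ∈ S, a x • hν.basisVector hp x), Lp.coeFn_smul (a y) (hν.basisVector hp y),
      hν.coeFn_basisVector hp y] with z h1 h2 h3 h4
    rw [h2, Pi.add_apply, h1, h3, Pi.smul_apply, h4, Finset.sum_insert hy, smul_eq_mul]

/-- The net of finite sets in `IsEggSeries` is the one in `HasSum`, and on the boundary `eggTerm` is
a monomial; only the sign of the difference changes. -/
theorem isEggSeries_iff_hasSum (hν : IsEggMeasure p ν) (hp : 0 < p) (a : ℕ × ℕ → ℂ)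
    (f : Lp ℂ 2 ν) :
    IsEggSeries p ν a f ↔ HasSum (fun x => a x • hν.basisVector hp x) f := by
  rw [HasSum, Lp.tendsto_Lp_iff_tendsto_eLpNorm', IsEggSeries]
  refine iff_of_eq ?_
  congr 1
  funext S
  rw [← eLpNorm_neg]
  refine eLpNorm_congr_ae ?_
  have h1 := hν.coeFn_sum_basisVector hp S a
  filter_upwards [h1, hν.ae_mem_frontier] with z hz hz'
  rw [Pi.neg_apply, Pi.sub_apply, hz, neg_sub]
  simp only [eggTerm_eggCoords hp hz']

theorem hardySpace_eq (hν : IsEggMeasure p ν) (hp : 0 < p) :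
    hardySpace (egg p) ν = {f | ∃ a : ℕ × ℕ → ℂ, HasSum (fun x => a x • hν.basisVector hp x) f} := by
  have := hν.finite
  rw [← closure_span_eq_of_orthogonal (hν.pairwise_inner_basisVector hp)
    (hν.basisVector_ne_zero hp)]
  apply Set.Subset.antisymm
  · refine closure_minimal ?_ isClosed_closure
    rintro f ⟨F, ⟨hd, hc⟩, hfF⟩
    rw [hν.support_eq, egg_union_frontier hp] at hc
    rw [Metric.mem_closure_iff]
    intro ε hε
    -- A uniform error `δ` costs at most `m δ` in `L²`, with `m = ν(univ)^{1/2}`. The tolerance `ε /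
    -- (2 (m + 1))` keeps this below `ε`, also when `m = 0`.
    set m : ℝ := measureUnivNNReal ν ^ (2 : ℝ≥0∞).toReal⁻¹ with hm
    have hm0 : 0 ≤ m := by positivity
    obtain ⟨S, c, hS⟩ := exists_polynomial_approx hp hd hc
      (ε := ε / (2 * (m + 1))) (by positivity)
    refine ⟨∑ x ∈ S, c x • hν.basisVector hp x, Submodule.sum_mem _ fun i _ =>
      Submodule.smul_mem _ _ (Submodule.subset_span (Set.mem_range_self i)), ?_⟩
    rw [dist_eq_norm]
    refine lt_of_le_of_lt (Lp.norm_le_of_ae_bound (C := ε / (2 * (m + 1))) (by positivity) ?_) ?_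
    · filter_upwards [hν.coeFn_sum_basisVector hp S c,
        Lp.coeFn_sub f (∑ x ∈ S, c x • hν.basisVector hp x), hfF,
        hν.ae_mem_frontier] with z h1 h2 h3 h4
      rw [h2, Pi.sub_apply, h1, h3]
      rw [frontier_egg hp] at h4
      exact hS z (le_of_eq h4)
    · rw [← hm, mul_div_assoc', div_lt_iff₀ (by positivity)]
      nlinarith
  · refine closure_mono ?_
    intro f hf
    obtain ⟨c, rfl⟩ := Finsupp.mem_span_range_iff_exists_finsupp.1 hf
    refine ⟨fun z => ∑ x ∈ c.support, c x * coordMonomial x z, ⟨?_, ?_⟩,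
      hν.coeFn_sum_basisVector hp c.support c⟩
    · refine Differentiable.differentiableOn ?_
      have := differentiable_coordMonomial
      fun_prop
    · refine Continuous.continuousOn ?_
      have := continuous_coordMonomial
      fun_prop

/-- Two-sided bounds on the monomial norms suffice for summability, so the exact moments are never
needed. -/
theorem summable_iff (hν : IsEggMeasure p ν) (hp : 0 < p) {w : ℕ × ℕ → ℝ} {c C : ℝ} (hc : 0 < c)
    (hw : ∀ x, 0 ≤ w x)
    (hl : ∀ x, c * w x ≤ ∫ z, ‖coordMonomial x z‖ ^ 2 ∂ν)
    (hu : ∀ x, ∫ z, ‖coordMonomial x z‖ ^ 2 ∂ν ≤ C * w x) (a : ℕ × ℕ → ℂ) :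
    (Summable fun x => a x • hν.basisVector hp x) ↔ Summable fun x => ‖a x‖ ^ 2 * w x := by
  rw [summable_smul_iff_of_orthogonal (hν.pairwise_inner_basisVector hp)
    (hν.basisVector_ne_zero hp)]
  simp only [hν.norm_sq_basisVector hp]
  constructor
  · intro h
    refine Summable.of_nonneg_of_le (fun x => mul_nonneg (by positivity) (hw x)) (fun x => ?_)
      (h.mul_left c⁻¹)
    rw [mul_left_comm]
    gcongr
    rw [inv_mul_eq_div, le_div_iff₀ hc, mul_comm]
    exact hl x
  · intro h
    refine Summable.of_nonneg_of_le (fun x => by positivity) (fun x => ?_) (h.mul_left C)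
    rw [mul_left_comm]
    gcongr
    exact hu x

/-- The Hardy space of a boundary measure whose monomial norms are comparable to the weights `w`. -/
theorem hardySpace_characterization (hν : IsEggMeasure p ν) (hp : 0 < p) {w : ℕ × ℕ → ℝ}
    {c C : ℝ} (hc : 0 < c) (hw : ∀ x, 0 ≤ w x)
    (hl : ∀ x, c * w x ≤ ∫ z, ‖coordMonomial x z‖ ^ 2 ∂ν)
    (hu : ∀ x, ∫ z, ‖coordMonomial x z‖ ^ 2 ∂ν ≤ C * w x) :
    (∀ a : ℕ × ℕ → ℂ, (Summable fun x => ‖a x‖ ^ 2 * w x) →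
        ∃ f : Lp ℂ 2 ν, IsEggSeries p ν a f) ∧
      hardySpace (egg p) ν = {f : Lp ℂ 2 ν | ∃ a : ℕ × ℕ → ℂ,
        (Summable fun x => ‖a x‖ ^ 2 * w x) ∧ IsEggSeries p ν a f} := by
  refine ⟨fun a ha => ?_, ?_⟩
  · obtain ⟨f, hf⟩ := (hν.summable_iff hp hc hw hl hu a).2 ha
    exact ⟨f, (hν.isEggSeries_iff_hasSum hp a f).2 hf⟩
  · rw [hν.hardySpace_eq hp]
    ext f
    refine exists_congr fun a => ?_
    rw [hν.isEggSeries_iff_hasSum hp, ← hν.summable_iff hp hc hw hl hu a]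
    exact ⟨fun h => ⟨h.summable, h⟩, fun h => h.2⟩

end IsEggMeasure

end

noncomputable section

/-! ### Hausdorff measure and Lipschitz parametrizations -/

theorem LipschitzOnWith.euclideanHausdorffMeasure_image_le {X Y : Type*} [EMetricSpace X]
    [MeasurableSpace X] [BorelSpace X] [EMetricSpace Y] [MeasurableSpace Y] [BorelSpace Y]
    {K : NNReal} {f : X → Y} {s : Set X} (h : LipschitzOnWith K f s) (d : ℕ) :
    (μHE[d] : Measure Y) (f '' s) ≤ (K : ℝ≥0∞) ^ d * (μHE[d] : Measure X) s := by
  simp only [Measure.euclideanHausdorffMeasure_def, Measure.smul_apply, ENNReal.smul_def,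
    smul_eq_mul]
  rw [mul_left_comm]
  gcongr
  simpa using h.hausdorffMeasure_image_le (d := d) (by positivity)

/-- The product `ℂ × ℝ` carries the maximum metric, so the measures need not agree; both are Haar
measures, hence proportional. -/
theorem exists_euclideanHausdorffMeasure_eq_smul_volume :
    ∃ k : NNReal, k ≠ 0 ∧ (μHE[3] : Measure (ℂ × ℝ)) = k • volume := by
  have h3 : Module.finrank ℝ (ℂ × ℝ) = 3 := by simp
  have h1 : (μHE[3] : Measure (ℂ × ℝ)).IsAddHaarMeasure := by
    rw [← h3]; infer_instance
  have h2 : (volume : Measure (ℂ × ℝ)).IsAddHaarMeasure :=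
    inferInstanceAs ((volume : Measure ℂ).prod (volume : Measure ℝ)).IsAddHaarMeasure
  have h := Measure.isAddLeftInvariant_eq_smul (μHE[3] : Measure (ℂ × ℝ)) volume
  refine ⟨_, fun h0 => ?_, h⟩
  rw [h0, zero_smul] at h
  exact NeZero.ne (μHE[3] : Measure (ℂ × ℝ)) h

/-- The parametrization `(w, θ) ↦ (w, (1 - |w|^{2p})^{1/2p} e^{iθ})` of `b𝓔ₚ`. -/
def graphParam (p : ℕ) (q : ℂ × ℝ) : C2 :=
  !₂[q.1, (((1 - ‖q.1‖ ^ (2 * p)) ^ (1 / (2 * p : ℝ)) : ℝ) : ℂ) * unitCirc q.2]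

variable {p : ℕ}

theorem continuous_graphParam (p : ℕ) : Continuous (graphParam p) := by
  have h1 : Continuous fun q : ℂ × ℝ => (1 - ‖q.1‖ ^ (2 * p)) ^ (1 / (2 * p : ℝ)) :=
    (Real.continuous_rpow_const (by positivity)).comp (by fun_prop)
  have h2 := continuous_unitCirc
  unfold graphParam
  fun_prop

theorem contDiffAt_graphParam {q : ℂ × ℝ} (hq : ‖q.1‖ ^ (2 * p) < 1) :
    ContDiffAt ℝ 1 (graphParam p) q := by
  have h1 : ContDiffAt ℝ 1 (fun q : ℂ × ℝ => (1 - ‖q.1‖ ^ (2 * p)) ^ (1 / (2 * p : ℝ))) q := by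
    refine ContDiffAt.rpow_const_of_ne ?_ (by linarith)
    refine contDiffAt_const.sub ?_
    simp only [pow_mul]
    exact ((contDiff_norm_sq ℝ).contDiffAt.comp q contDiffAt_fst).pow p
  have h2 : ContDiff ℝ 1 unitCirc := by
    unfold unitCirc
    exact ((Complex.ofRealCLM.contDiff).mul contDiff_const).cexp
  rw [contDiffAt_piLp]
  intro i
  fin_cases i
  · exact contDiffAt_fst
  · exact (Complex.ofRealCLM.contDiff.contDiffAt.comp q h1).mul
      (h2.contDiffAt.comp q contDiffAt_snd)

/-- The bound `2/3` keeps away from `|w| = 1`, where the radius `(1 - |w|^{2p})^{1/2p}` has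
unbounded derivative. On the remaining compact set the map is `C¹`. -/
theorem exists_lipschitzOnWith_graphParam (p : ℕ) (hp : 0 < p) (a b : ℝ) :
    ∃ K, LipschitzOnWith K (graphParam p) ({w : ℂ | ‖w‖ ^ (2 * p) ≤ 2 / 3} ×ˢ Set.Icc a b) := by
  refine LocallyLipschitzOn.exists_lipschitzOnWith_of_compact ?_ ?_
  · refine IsCompact.prod ?_ isCompact_Icc
    refine Metric.isCompact_of_isClosed_isBounded (isClosed_le (by fun_prop) continuous_const) ?_
    refine (Metric.isBounded_closedBall (x := (0 : ℂ)) (r := 1)).subset fun w hw => ?_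
    rw [mem_closedBall_zero_iff]
    have : ‖w‖ ^ (2 * p) ≤ 1 := le_trans hw (by norm_num)
    exact (pow_le_one_iff_of_nonneg (norm_nonneg _) (by omega)).1 this
  · rintro q ⟨h1, -⟩
    obtain ⟨K, t, ht, hK⟩ := (contDiffAt_graphParam (p := p) (q := q)
      (lt_of_le_of_lt h1 (by norm_num))).exists_lipschitzOnWith
    exact ⟨K, t, mem_nhdsWithin_of_mem_nhds ht, hK⟩

theorem third_le_graph_radius (hp : 0 < p) {t : ℝ} (h0 : 0 ≤ t) (ht : t ≤ 2 / 3) :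
    1 / 3 ≤ (1 - t) ^ (1 / (2 * p : ℝ)) := by
  have hp' : (1 : ℝ) ≤ p := by exact_mod_cast hp
  have he : 1 / (2 * p : ℝ) ≤ 1 := by
    rw [div_le_one (by positivity)]; linarith
  calc (1 / 3 : ℝ) ≤ 1 - t := by linarith
    _ = (1 - t) ^ (1 : ℝ) := (Real.rpow_one _).symm
    _ ≤ (1 - t) ^ (1 / (2 * p : ℝ)) :=
      Real.rpow_le_rpow_of_exponent_ge (by linarith) (by linarith) he

/-- After rotation by `-θ'` the second point is real, so the distance is at least `ρ |sin (θ -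
θ')|`. The constant is `6 = 3 * 2`, from `ρ ≥ 1/3` and `|sin x| ≥ |x|/2` for `|x| ≤ 1`. -/
theorem abs_sub_le_norm_polar_sub {ρ ρ' θ θ' : ℝ} (hρ : 1 / 3 ≤ ρ) (h : |θ - θ'| ≤ 1) :
    |θ - θ'| ≤ 6 * ‖(ρ : ℂ) * unitCirc θ - ρ' * unitCirc θ'‖ := by
  have h1 : ‖(ρ : ℂ) * unitCirc θ - ρ' * unitCirc θ'‖ = ‖(ρ : ℂ) * unitCirc (θ - θ') - ρ'‖ := by
    have : (ρ : ℂ) * unitCirc θ - ρ' * unitCirc θ' =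
        unitCirc θ' * ((ρ : ℂ) * unitCirc (θ - θ') - ρ') := by
      have : unitCirc θ = unitCirc θ' * unitCirc (θ - θ') := by
        unfold unitCirc
        rw [← Complex.exp_add]
        congr 1
        push_cast
        ring
      rw [this]
      ring
    rw [this, norm_mul, norm_unitCirc, one_mul]
  have h2 : ((ρ : ℂ) * unitCirc (θ - θ') - ρ').im = ρ * Real.sin (θ - θ') := by
    unfold unitCirc
    rw [Complex.exp_mul_I, ← Complex.ofReal_cos, ← Complex.ofReal_sin, Complex.sub_im,
      Complex.im_ofReal_mul]
    simp [-Complex.ofReal_sub, -Complex.ofReal_cos, -Complex.ofReal_sin]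
  have h3 := Complex.abs_im_le_norm ((ρ : ℂ) * unitCirc (θ - θ') - ρ')
  rw [h2, abs_mul, abs_of_pos (by linarith)] at h3
  have h4 := Real.mul_abs_le_abs_sin (x := θ - θ') (by linarith [Real.pi_gt_three])
  rw [h1]
  have h5 : 1 / 2 ≤ 2 / Real.pi := by
    rw [div_le_div_iff₀ (by norm_num) Real.pi_pos]
    linarith [Real.pi_le_four]
  have h6 : 0 ≤ |θ - θ'| := abs_nonneg _
  have h7 : 1 / 2 * |θ - θ'| ≤ |Real.sin (θ - θ')| := le_trans (by gcongr) h4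
  nlinarith

theorem dist_le_dist_graphParam (hp : 0 < p) {q q' : ℂ × ℝ} (hq : ‖q.1‖ ^ (2 * p) ≤ 2 / 3)
    (h : |q.2 - q'.2| ≤ 1) :
    dist q q' ≤ 6 * dist (graphParam p q) (graphParam p q') := by
  have hn : ∀ i, ‖graphParam p q i - graphParam p q' i‖ ≤
      dist (graphParam p q) (graphParam p q') := fun i => by
    rw [dist_eq_norm]
    exact PiLp.norm_apply_le (graphParam p q - graphParam p q') i
  have h0 : ‖q.1 - q'.1‖ ≤ _ := hn 0
  have h1 := abs_sub_le_norm_polar_sub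
    (ρ' := (1 - ‖q'.1‖ ^ (2 * p)) ^ (1 / (2 * p : ℝ)))
    (third_le_graph_radius hp (by positivity) hq) h
  have h2 := hn 1
  have h3 : 0 ≤ dist (graphParam p q) (graphParam p q') := dist_nonneg
  rw [Prod.dist_eq, dist_eq_norm, Real.dist_eq]
  refine max_le (by linarith) (h1.trans ?_)
  gcongr
  exact h2

/-- On an angular window of length `1` the parametrization is injective with a `6`-Lipschitz
inverse. Applying this inverse to the image of `A` recovers `A`. -/
theorem volume_le_hausdorff_graphParam_image (hp : 0 < p) :
    ∃ C : NNReal, ∀ (a : ℝ) (A : Set (ℂ × ℝ)),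
      A ⊆ {w : ℂ | ‖w‖ ^ (2 * p) ≤ 2 / 3} ×ˢ Set.Icc a (a + 1) →
      volume A ≤ C * (μHE[3] : Measure C2) (graphParam p '' A) := by
  obtain ⟨k, hk0, hk⟩ := exists_euclideanHausdorffMeasure_eq_smul_volume
  refine ⟨k⁻¹ * 6 ^ 3, fun a A hA => ?_⟩
  have hdist : ∀ q ∈ A, ∀ q' ∈ A, dist q q' ≤ 6 * dist (graphParam p q) (graphParam p q') := by
    intro q hq q' hq'
    have h1 := (hA hq).2
    have h2 := (hA hq').2
    refine dist_le_dist_graphParam hp (hA hq).1 ?_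
    rw [abs_le]
    constructor <;> linarith [h1.1, h1.2, h2.1, h2.2]
  have hinj : Set.InjOn (graphParam p) A := fun q hq q' hq' he => by
    have := hdist q hq q' hq'
    rw [he, dist_self, mul_zero] at this
    exact dist_le_zero.1 this
  have hL : LipschitzOnWith 6 (Function.invFunOn (graphParam p) A) (graphParam p '' A) := by
    refine LipschitzOnWith.of_dist_le_mul ?_
    rintro _ ⟨q, hq, rfl⟩ _ ⟨q', hq', rfl⟩
    rw [hinj.leftInvOn_invFunOn hq, hinj.leftInvOn_invFunOn hq']
    exact hdist q hq q' hq'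
  have himg : Function.invFunOn (graphParam p) A '' (graphParam p '' A) = A := by
    rw [Set.image_image]
    exact (Set.image_congr fun q hq => hinj.leftInvOn_invFunOn hq).trans (Set.image_id' A)
  have h := hL.euclideanHausdorffMeasure_image_le 3
  rw [himg, hk, Measure.smul_apply, ENNReal.smul_def, smul_eq_mul] at h
  have hk' : (k : ℝ≥0∞) ≠ 0 := by simpa using hk0
  calc volume A = (k : ℝ≥0∞)⁻¹ * (k * volume A) := by
        rw [← mul_assoc, ENNReal.inv_mul_cancel hk' ENNReal.coe_ne_top, one_mul]
    _ ≤ (k : ℝ≥0∞)⁻¹ * ((6 : NNReal) ^ 3 * μHE[3] (graphParam p '' A)) := by gcongr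
    _ = _ := by
      rw [← mul_assoc, ENNReal.coe_mul, ENNReal.coe_inv hk0]
      simp

theorem hausdorff_graphParam_image_le_volume (hp : 0 < p) :
    ∃ C : NNReal, ∀ A : Set (ℂ × ℝ),
      A ⊆ {w : ℂ | ‖w‖ ^ (2 * p) ≤ 2 / 3} ×ˢ Set.Icc 0 (2 * Real.pi) →
      (μHE[3] : Measure C2) (graphParam p '' A) ≤ C * volume A := by
  obtain ⟨k, hk0, hk⟩ := exists_euclideanHausdorffMeasure_eq_smul_volume
  obtain ⟨K, hK⟩ := exists_lipschitzOnWith_graphParam p hp 0 (2 * Real.pi)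
  refine ⟨K ^ 3 * k, fun A hA => ?_⟩
  refine ((hK.mono hA).euclideanHausdorffMeasure_image_le 3).trans (le_of_eq ?_)
  rw [hk, Measure.smul_apply, ENNReal.smul_def, smul_eq_mul, ← mul_assoc]
  simp

/-- The part `|z₁|^{2p} ≤ 2/3` of `b𝓔ₚ`. -/
def eggCap (p : ℕ) : Set C2 := {z | z ∈ frontier (egg p) ∧ ‖z 0‖ ^ (2 * p) ≤ 2 / 3}

/-- The domain of the parametrization of `eggCap`. -/
def capDomain (p : ℕ) : Set (ℂ × ℝ) :=
  {w : ℂ | ‖w‖ ^ (2 * p) ≤ 2 / 3} ×ˢ Set.Ioc 0 (2 * Real.pi)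

/-- Lebesgue measure in the parametrization of `eggCap`. -/
def capMeasure (p : ℕ) : Measure C2 :=
  (volume.restrict (capDomain p)).map (graphParam p)

theorem measurableSet_eggCap (p : ℕ) : MeasurableSet (eggCap p) :=
  isClosed_frontier.measurableSet.inter
    (isClosed_le (f := fun z : C2 => ‖z 0‖ ^ (2 * p)) (by fun_prop) continuous_const).measurableSet

theorem rpow_inv_two_mul_pow (hp : 0 < p) {t : ℝ} (ht : 0 ≤ t) :
    (t ^ (1 / (2 * p : ℝ))) ^ (2 * p) = t := by
  rw [← Real.rpow_natCast, ← Real.rpow_mul ht]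
  have : (1 / (2 * p : ℝ)) * ((2 * p : ℕ) : ℝ) = 1 := by
    push_cast
    field_simp
  rw [this, Real.rpow_one]

theorem graphParam_mem_eggCap (hp : 0 < p) {q : ℂ × ℝ} (hq : ‖q.1‖ ^ (2 * p) ≤ 2 / 3) :
    graphParam p q ∈ eggCap p := by
  refine ⟨?_, hq⟩
  rw [frontier_egg hp]
  change eggRho p _ = 1
  have h1 : 0 ≤ 1 - ‖q.1‖ ^ (2 * p) := by linarith
  rw [graphParam, eggRho_pair, norm_mul, norm_unitCirc, mul_one, Complex.norm_real,
    Real.norm_of_nonneg (by positivity), rpow_inv_two_mul_pow hp h1]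
  ring

theorem exists_unitCirc_eq (w : ℂ) :
    ∃ θ ∈ Set.Ioc 0 (2 * Real.pi), (‖w‖ : ℂ) * unitCirc θ = w := by
  refine ⟨toIocMod Real.two_pi_pos 0 w.arg, ?_, ?_⟩
  · simpa using toIocMod_mem_Ioc Real.two_pi_pos 0 w.arg
  · have : unitCirc (toIocMod Real.two_pi_pos 0 w.arg) = Complex.exp (w.arg * Complex.I) := by
      unfold unitCirc
      rw [← self_sub_toIocDiv_zsmul, Complex.exp_eq_exp_iff_exists_int]
      refine ⟨-toIocDiv Real.two_pi_pos 0 w.arg, ?_⟩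
      simp only [zsmul_eq_mul]
      push_cast
      ring
    rw [this, Complex.norm_mul_exp_arg_mul_I]

theorem exists_graphParam_eq (hp : 0 < p) {z : C2} (hz : z ∈ eggCap p) :
    ∃ q ∈ capDomain p, graphParam p q = z := by
  obtain ⟨hz1, hz2⟩ := hz
  rw [frontier_egg hp] at hz1
  have hz1' : ‖z 0‖ ^ (2 * p) + ‖z 1‖ ^ (2 * p) = 1 := hz1
  obtain ⟨θ, hθ, he⟩ := exists_unitCirc_eq (z 1)
  refine ⟨(z 0, θ), ⟨hz2, hθ⟩, ?_⟩
  have h1 : (1 - ‖z 0‖ ^ (2 * p)) ^ (1 / (2 * p : ℝ)) = ‖z 1‖ := by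
    have h2 : 1 - ‖z 0‖ ^ (2 * p) = ‖z 1‖ ^ (2 * p) := by linarith
    rw [h2]
    refine (pow_left_inj₀ (by positivity) (norm_nonneg _) (n := 2 * p) (by omega)).1 ?_
    rw [rpow_inv_two_mul_pow hp (by positivity)]
  rw [graphParam]
  simp only [h1, he]
  exact pair_eta z

theorem eggSigma_cap_le (hp : 0 < p) :
    ∃ C : NNReal, (eggSigma p).restrict (eggCap p) ≤ C • capMeasure p := by
  obtain ⟨C, hC⟩ := hausdorff_graphParam_image_le_volume hp
  refine ⟨C, Measure.le_iff.2 fun B hB => ?_⟩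
  have hm := (continuous_graphParam p).measurable
  rw [Measure.restrict_apply hB, Measure.smul_apply, ENNReal.smul_def, smul_eq_mul, capMeasure,
    Measure.map_apply hm hB, Measure.restrict_apply (hm hB), eggSigma, surfaceMeasure]
  refine (Measure.restrict_le_self _).trans (le_trans (measure_mono ?_) (hC _ ?_))
  · rintro z ⟨hzB, hz⟩
    obtain ⟨q, hq, rfl⟩ := exists_graphParam_eq hp hz
    exact ⟨q, ⟨hzB, hq⟩, rfl⟩
  · rintro q ⟨-, h1, h2⟩
    exact ⟨h1, Set.Ioc_subset_Icc_self h2⟩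

theorem eggSigma_eq_of_subset {B : Set C2} (hB : B ⊆ frontier (egg p)) :
    eggSigma p B = (μHE[3] : Measure C2) B := by
  rw [eggSigma, surfaceMeasure, Measure.restrict_apply' isClosed_frontier.measurableSet,
    Set.inter_eq_left.2 hB]

theorem capMeasure_le (hp : 0 < p) :
    ∃ C : NNReal, capMeasure p ≤ C • (eggSigma p).restrict (eggCap p) := by
  obtain ⟨C, hC⟩ := volume_le_hausdorff_graphParam_image hp
  -- Seven windows of length `1` cover `(0, 2π]`, as `2π < 7`.
  refine ⟨7 * C, Measure.le_iff.2 fun B hB => ?_⟩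
  have hm := (continuous_graphParam p).measurable
  rw [Measure.smul_apply, ENNReal.smul_def, smul_eq_mul, Measure.restrict_apply hB, capMeasure,
    Measure.map_apply hm hB, Measure.restrict_apply (hm hB)]
  set A : ℕ → Set (ℂ × ℝ) := fun k =>
    (graphParam p ⁻¹' B ∩ capDomain p) ∩ {q | q.2 ∈ Set.Icc (k : ℝ) (k + 1)} with hA
  have hcover : graphParam p ⁻¹' B ∩ capDomain p ⊆ ⋃ k ∈ Finset.range 7, A k := by
    intro q hq
    have h1 := hq.2.2.1
    have h2 := hq.2.2.2
    simp only [Set.mem_iUnion, Finset.mem_range]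
    refine ⟨⌊q.2⌋₊, ?_, hq, Nat.floor_le h1.le, (Nat.lt_floor_add_one _).le⟩
    rw [Nat.floor_lt h1.le]
    push_cast
    linarith [Real.pi_lt_d2]
  calc volume (graphParam p ⁻¹' B ∩ capDomain p)
      ≤ volume (⋃ k ∈ Finset.range 7, A k) := measure_mono hcover
    _ ≤ ∑ k ∈ Finset.range 7, volume (A k) := measure_biUnion_finset_le _ _
    _ ≤ ∑ _k ∈ Finset.range 7, (C : ℝ≥0∞) * eggSigma p (B ∩ eggCap p) := by
        refine Finset.sum_le_sum fun k _ => ?_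
        refine (hC k (A k) fun q hq => ⟨hq.1.2.1, hq.2⟩).trans ?_
        refine mul_le_mul_right ?_ _
        rw [eggSigma_eq_of_subset (Set.inter_subset_right.trans fun z hz => hz.1)]
        refine measure_mono ?_
        rintro _ ⟨q, hq, rfl⟩
        exact ⟨hq.1.1, graphParam_mem_eggCap hp hq.1.2.1⟩
    _ = ((7 * C : NNReal) : ℝ≥0∞) * eggSigma p (B ∩ eggCap p) := by
        rw [Finset.sum_const, Finset.card_range, nsmul_eq_mul, ← mul_assoc]
        push_cast
        rfl

theorem eggSigma_pos_of_mem_nhds (hp : 0 < p) {z : C2} (hz : z ∈ frontier (egg p))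
    (hz0 : ‖z 0‖ ^ (2 * p) < 2 / 3) {U : Set C2} (hU : U ∈ 𝓝 z) : 0 < eggSigma p U := by
  obtain ⟨V, hVU, hV, hzV⟩ := mem_nhds_iff.1 hU
  obtain ⟨C, hC⟩ := volume_le_hausdorff_graphParam_image hp
  obtain ⟨q, -, hq⟩ := exists_graphParam_eq hp ⟨hz, hz0.le⟩
  -- The window is centred at the angle of `z` and may leave `(0, 2π]`; this keeps `A` an open
  -- neighbourhood of `q` even when the angle is `2π`.
  set A : Set (ℂ × ℝ) := graphParam p ⁻¹' V ∩
    {w : ℂ | ‖w‖ ^ (2 * p) < 2 / 3} ×ˢ Set.Ioo (q.2 - 1 / 2) (q.2 + 1 / 2) with hA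
  have hAo : IsOpen A := (hV.preimage (continuous_graphParam p)).inter
    ((isOpen_lt (by fun_prop) continuous_const).prod isOpen_Ioo)
  have hqA : q ∈ A := by
    refine ⟨?_, ?_, ?_⟩
    · rwa [Set.mem_preimage, hq]
    · rw [← hq] at hz0
      exact hz0
    · constructor <;> linarith
  have hvol : 0 < volume A := by
    have : (volume : Measure (ℂ × ℝ)).IsAddHaarMeasure :=
      inferInstanceAs ((volume : Measure ℂ).prod (volume : Measure ℝ)).IsAddHaarMeasure
    exact hAo.measure_pos _ ⟨q, hqA⟩
  have hle := hC (q.2 - 1 / 2) A fun q' hq' =>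
    ⟨(show ‖q'.1‖ ^ (2 * p) < 2 / 3 from hq'.2.1).le, hq'.2.2.1.le, by linarith [hq'.2.2.2]⟩
  have hsub : graphParam p '' A ⊆ frontier (egg p) := by
    rintro _ ⟨q', hq', rfl⟩
    exact (graphParam_mem_eggCap hp (le_of_lt hq'.2.1)).1
  rw [← eggSigma_eq_of_subset hsub] at hle
  have h1 : 0 < eggSigma p (graphParam p '' A) := by
    rw [pos_iff_ne_zero]
    intro h0
    rw [h0, mul_zero] at hle
    exact absurd hle (not_le.2 hvol)
  refine h1.trans_le (measure_mono ?_)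
  rintro _ ⟨q', hq', rfl⟩
  exact hVU hq'.1

end

/-! ### The cap in the coordinate `s` -/

noncomputable section

variable {p : ℕ}

theorem lintegral_comp_norm_complex {G : ℝ → ℝ≥0∞} (hG : Measurable G) :
    ∫⁻ w : ℂ, G ‖w‖ = ENNReal.ofReal (2 * Real.pi) *
      ∫⁻ r in Set.Ioi (0 : ℝ), ENNReal.ofReal r * G r := by
  rw [← Complex.lintegral_comp_polarCoord_symm]
  simp only [Complex.norm_polarCoord_symm, polarCoord_target, smul_eq_mul]
  have hm : Measurable fun q : ℝ × ℝ => ENNReal.ofReal q.1 * G |q.1| := by fun_prop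
  rw [Measure.volume_eq_prod, ← Measure.prod_restrict, lintegral_prod _ hm.aemeasurable]
  simp only [lintegral_const, Measure.restrict_apply MeasurableSet.univ, Set.univ_inter,
    Real.volume_Ioo]
  rw [lintegral_mul_const _ (by fun_prop), mul_comm]
  congr 1
  · congr 1; ring
  · refine setLIntegral_congr_fun measurableSet_Ioi fun r hr => ?_
    simp only [abs_of_pos (show 0 < r from hr)]

/-- The substitution `r = s^{1/2p}` turns `r dr` into `(1/2p) s^{1/p-1} ds`. -/
theorem lintegral_Ioi_comp_pow (hp : 0 < p) (G : ℝ → ℝ≥0∞) :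
    ∫⁻ r in Set.Ioi (0 : ℝ), ENNReal.ofReal r * G (r ^ (2 * p)) =
      ENNReal.ofReal (1 / (2 * p)) *
        ∫⁻ s in Set.Ioi (0 : ℝ), G s * ENNReal.ofReal (s ^ (1 / (p : ℝ) - 1)) := by
  have hp' : (0 : ℝ) < p := by exact_mod_cast hp
  set e : ℝ := 1 / (2 * p : ℝ) with he
  have he0 : 0 < e := by positivity
  have himg : (fun s : ℝ => s ^ e) '' Set.Ioi 0 = Set.Ioi 0 := by
    ext r
    constructor
    · rintro ⟨s, hs, rfl⟩
      exact Real.rpow_pos_of_pos hs _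
    · intro hr
      refine ⟨r ^ e⁻¹, Real.rpow_pos_of_pos hr _, ?_⟩
      exact Real.rpow_inv_rpow (le_of_lt hr) he0.ne'
  have h := lintegral_image_eq_lintegral_abs_deriv_mul (s := Set.Ioi (0 : ℝ))
    (f := fun s : ℝ => s ^ e) (f' := fun s => e * s ^ (e - 1)) measurableSet_Ioi
    (fun s hs => (Real.hasDerivAt_rpow_const (Or.inl (ne_of_gt hs))).hasDerivWithinAt)
    (fun s hs t ht hst => by
      exact (Real.rpow_left_inj (le_of_lt hs) (le_of_lt ht) he0.ne').1 hst)
    (fun r => ENNReal.ofReal r * G (r ^ (2 * p)))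
  rw [himg] at h
  rw [h, ← lintegral_const_mul' _ _ ENNReal.ofReal_ne_top]
  refine setLIntegral_congr_fun measurableSet_Ioi fun s hs => ?_
  have hs' : 0 < s := hs
  have h1 : (s ^ e) ^ (2 * p) = s := rpow_inv_two_mul_pow hp hs'.le
  have h2 : s ^ (1 / (p : ℝ) - 1) = s ^ (e - 1) * s ^ e := by
    rw [← Real.rpow_add hs']
    congr 1
    rw [he]
    field_simp
    ring
  simp only [h1]
  rw [abs_of_nonneg (by positivity), h2, ENNReal.ofReal_mul he0.le,
    ENNReal.ofReal_mul (by positivity)]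
  ring

/-- The constant relating `capMeasure` to the coordinate `s`. -/
def capConst (p : ℕ) : NNReal := Real.toNNReal (2 * Real.pi) ^ 2 * Real.toNNReal (1 / (2 * p))

theorem capConst_pos (hp : 0 < p) : 0 < capConst p := by
  have hp' : (0 : ℝ) < p := by exact_mod_cast hp
  unfold capConst
  have h1 : 0 < Real.toNNReal (2 * Real.pi) := Real.toNNReal_pos.2 Real.two_pi_pos
  have h2 : 0 < Real.toNNReal (1 / (2 * p : ℝ)) := Real.toNNReal_pos.2 (by positivity)
  positivity

/-- One factor `2π` comes from the free angle `θ`, the other from polar coordinates in `w`, and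
`1/2p` from the radial substitution. -/
theorem lintegral_capMeasure (hp : 0 < p) {g : ℝ → ℝ≥0∞} (hg : Measurable g) :
    ∫⁻ z, g (‖z 0‖ ^ (2 * p)) ∂capMeasure p =
      capConst p * ∫⁻ s in Set.Ioc (0 : ℝ) (2 / 3), g s * ENNReal.ofReal (s ^ (1 / (p : ℝ) - 1)) := by
  have hm := (continuous_graphParam p).measurable
  have hz : Measurable fun z : C2 => g (‖z 0‖ ^ (2 * p)) :=
    hg.comp (Continuous.measurable (by fun_prop))
  rw [capMeasure, lintegral_map hz hm, capDomain, Measure.volume_eq_prod, ← Measure.prod_restrict,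
    lintegral_prod (fun q => g (‖graphParam p q 0‖ ^ (2 * p))) (hz.comp hm).aemeasurable]
  have h0 : ∀ w θ, graphParam p (w, θ) 0 = w := fun _ _ => rfl
  simp only [h0, lintegral_const, Measure.restrict_apply MeasurableSet.univ, Set.univ_inter,
    Real.volume_Ioc, sub_zero]
  have hgw : Measurable fun w : ℂ => g (‖w‖ ^ (2 * p)) :=
    hg.comp (Continuous.measurable (by fun_prop))
  rw [lintegral_mul_const _ hgw]
  set G : ℝ → ℝ≥0∞ := (Set.Iic (2 / 3 : ℝ)).indicator g with hGdef
  have hG : Measurable G := hg.indicator measurableSet_Iic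
  have hind : ∫⁻ w in {w : ℂ | ‖w‖ ^ (2 * p) ≤ 2 / 3}, g (‖w‖ ^ (2 * p)) =
      ∫⁻ w : ℂ, G (‖w‖ ^ (2 * p)) := by
    rw [← lintegral_indicator (isClosed_le (f := fun w : ℂ => ‖w‖ ^ (2 * p)) (by fun_prop)
      continuous_const).measurableSet]
    rfl
  rw [hind, lintegral_comp_norm_complex (G := fun r => G (r ^ (2 * p)))
    (hG.comp (Continuous.measurable (by fun_prop))), lintegral_Ioi_comp_pow hp]
  have hI : ∫⁻ s in Set.Ioi (0 : ℝ), G s * ENNReal.ofReal (s ^ (1 / (p : ℝ) - 1)) =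
      ∫⁻ s in Set.Ioc (0 : ℝ) (2 / 3), g s * ENNReal.ofReal (s ^ (1 / (p : ℝ) - 1)) := by
    have : (fun s => G s * ENNReal.ofReal (s ^ (1 / (p : ℝ) - 1))) =
        (Set.Iic (2 / 3 : ℝ)).indicator fun s => g s * ENNReal.ofReal (s ^ (1 / (p : ℝ) - 1)) := by
      funext s
      by_cases hs : s ∈ Set.Iic (2 / 3 : ℝ) <;> simp [hGdef, hs]
    rw [this, lintegral_indicator measurableSet_Iic, Measure.restrict_restrict measurableSet_Iic,
      Set.inter_comm, Set.Ioi_inter_Iic]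
  rw [hI, capConst]
  push_cast
  simp only [ENNReal.ofReal]
  ring

/-! ### Symmetries of the surface measure -/

/-- Hausdorff measure is invariant under isometries, and such an `e` preserves the boundary. -/
theorem measurePreserving_eggSigma (e : C2 ≃ᵢ C2) (he : ∀ z, eggRho p (e z) = eggRho p z)
    (hp : 0 < p) : MeasurePreserving e (eggSigma p) (eggSigma p) := by
  have h := (e.measurePreserving_euclideanHausdorffMeasure 3).restrict_preimage
    (s := frontier (egg p)) isClosed_frontier.measurableSet
  have h2 : e ⁻¹' frontier (egg p) = frontier (egg p) := by
    rw [frontier_egg hp]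
    ext z
    simp [he]
  rw [h2] at h
  exact h

/-- The exchange of the two coordinates. -/
def swapIso : C2 ≃ᵢ C2 :=
  (LinearIsometryEquiv.piLpCongrLeft 2 ℂ ℂ (Equiv.swap (0 : Fin 2) 1)).toIsometryEquiv

theorem swapIso_zero (z : C2) : swapIso z 0 = z 1 := rfl

theorem swapIso_one (z : C2) : swapIso z 1 = z 0 := rfl

theorem measurePreserving_swapIso (hp : 0 < p) :
    MeasurePreserving swapIso (eggSigma p) (eggSigma p) :=
  measurePreserving_eggSigma _ (fun z => by
    simp [eggRho, swapIso_zero, swapIso_one, add_comm]) hp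

/-- The rotation `(z₁, z₂) ↦ (e^{iα} z₁, e^{iβ} z₂)`. -/
def torusIso (u : Fin 2 → Circle) : C2 ≃ᵢ C2 :=
  (LinearIsometryEquiv.piLpCongrRight 2 fun i => rotation (u i)).toIsometryEquiv

theorem torusIso_apply (u : Fin 2 → Circle) (z : C2) (i : Fin 2) :
    torusIso u z i = u i * z i := rfl

theorem measurePreserving_torusIso (hp : 0 < p) (u : Fin 2 → Circle) :
    MeasurePreserving (torusIso u) (eggSigma p) (eggSigma p) :=
  measurePreserving_eggSigma _ (fun z => by
    simp [eggRho, torusIso_apply, Circle.norm_coe]) hp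

/-! ### Comparison of the surface measure with the coordinate `s` -/

/-- The density `s^{1/p-1} (1-s)^{1/p-1}` on `(0, 1)`. -/
def betaDensity (p : ℕ) (s : ℝ) : ℝ := s ^ (1 / (p : ℝ) - 1) * (1 - s) ^ (1 / (p : ℝ) - 1)

theorem betaDensity_one_sub (p : ℕ) (s : ℝ) : betaDensity p (1 - s) = betaDensity p s := by
  rw [betaDensity, betaDensity, sub_sub_cancel, mul_comm]

/-- The exponent `1/p - 1` lies in `[-1, 0]` and `1 - s` in `[1/3, 1]`, so the second factor of the
density is between `1` and `3`. -/
theorem rpow_le_betaDensity (hp : 0 < p) {s : ℝ} (hs : s ∈ Set.Ioc (0 : ℝ) (2 / 3)) :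
    s ^ (1 / (p : ℝ) - 1) ≤ betaDensity p s ∧ betaDensity p s ≤ 3 * s ^ (1 / (p : ℝ) - 1) := by
  have hp' : (1 : ℝ) ≤ p := by exact_mod_cast hp
  have h1 : 1 / (p : ℝ) - 1 ≤ 0 := by
    rw [sub_nonpos, div_le_one (by linarith)]; exact hp'
  have h2 : -1 ≤ 1 / (p : ℝ) - 1 := by
    have : 0 ≤ 1 / (p : ℝ) := by positivity
    linarith
  have hs0 : 0 < s ^ (1 / (p : ℝ) - 1) := Real.rpow_pos_of_pos hs.1 _
  have hs1 : 0 < 1 - s := by linarith [hs.2]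
  have hs1' : 1 - s ≤ 1 := by linarith [hs.1]
  have a1 : 1 ≤ (1 - s) ^ (1 / (p : ℝ) - 1) :=
    Real.one_le_rpow_of_pos_of_le_one_of_nonpos hs1 hs1' h1
  have a2 : (1 - s) ^ (1 / (p : ℝ) - 1) ≤ 3 := by
    calc (1 - s) ^ (1 / (p : ℝ) - 1) ≤ (1 - s) ^ (-1 : ℝ) :=
          Real.rpow_le_rpow_of_exponent_ge hs1 hs1' h2
      _ = (1 - s)⁻¹ := Real.rpow_neg_one _
      _ ≤ (1 / 3)⁻¹ := inv_anti₀ (by norm_num) (by linarith [hs.2])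
      _ = 3 := by norm_num
  unfold betaDensity
  constructor <;> nlinarith

theorem measurable_betaDensity (p : ℕ) : Measurable (betaDensity p) := by
  unfold betaDensity; fun_prop

theorem lintegral_cap_comparison (hp : 0 < p) : ∃ C : NNReal, C ≠ 0 ∧ ∀ g : ℝ → ℝ≥0∞, Measurable g →
    ∫⁻ z in eggCap p, g (‖z 0‖ ^ (2 * p)) ∂eggSigma p ≤
      C * ∫⁻ s in Set.Ioc (0 : ℝ) (2 / 3), g s * ENNReal.ofReal (betaDensity p s) ∧
    ∫⁻ s in Set.Ioc (0 : ℝ) (2 / 3), g s * ENNReal.ofReal (betaDensity p s) ≤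
      C * ∫⁻ z in eggCap p, g (‖z 0‖ ^ (2 * p)) ∂eggSigma p := by
  obtain ⟨C₁, h₁⟩ := eggSigma_cap_le hp
  obtain ⟨C₂, h₂⟩ := capMeasure_le hp
  have hk := capConst_pos hp
  have hk' : (capConst p : ℝ≥0∞) ≠ 0 := by simpa using hk.ne'
  -- The first two summands serve the two inequalities; the last makes the constant nonzero.
  refine ⟨C₁ * capConst p + 3 * (capConst p)⁻¹ * C₂ + 1, by positivity, fun g hg => ?_⟩
  have hr1 : ∫⁻ s in Set.Ioc (0 : ℝ) (2 / 3), g s * ENNReal.ofReal (s ^ (1 / (p : ℝ) - 1)) ≤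
      ∫⁻ s in Set.Ioc (0 : ℝ) (2 / 3), g s * ENNReal.ofReal (betaDensity p s) := by
    refine setLIntegral_mono' measurableSet_Ioc fun s hs => ?_
    gcongr
    exact (rpow_le_betaDensity hp hs).1
  have hr2 : ∫⁻ s in Set.Ioc (0 : ℝ) (2 / 3), g s * ENNReal.ofReal (betaDensity p s) ≤
      3 * ∫⁻ s in Set.Ioc (0 : ℝ) (2 / 3), g s * ENNReal.ofReal (s ^ (1 / (p : ℝ) - 1)) := by
    rw [← lintegral_const_mul' _ _ (by norm_num)]
    refine setLIntegral_mono' measurableSet_Ioc fun s hs => ?_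
    rw [mul_left_comm]
    gcongr
    refine (ENNReal.ofReal_le_ofReal (rpow_le_betaDensity hp hs).2).trans (le_of_eq ?_)
    rw [ENNReal.ofReal_mul (by norm_num)]
    norm_num
  constructor
  · calc ∫⁻ z in eggCap p, g (‖z 0‖ ^ (2 * p)) ∂eggSigma p
        ≤ ∫⁻ z, g (‖z 0‖ ^ (2 * p)) ∂(C₁ • capMeasure p) := lintegral_mono' h₁ le_rfl
      _ = C₁ * (capConst p *
          ∫⁻ s in Set.Ioc (0 : ℝ) (2 / 3), g s * ENNReal.ofReal (s ^ (1 / (p : ℝ) - 1))) := by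
        rw [lintegral_smul_measure, lintegral_capMeasure hp hg]; rfl
      _ ≤ C₁ * (capConst p *
          ∫⁻ s in Set.Ioc (0 : ℝ) (2 / 3), g s * ENNReal.ofReal (betaDensity p s)) := by gcongr
      _ = ((C₁ * capConst p : NNReal) : ℝ≥0∞) *
          ∫⁻ s in Set.Ioc (0 : ℝ) (2 / 3), g s * ENNReal.ofReal (betaDensity p s) := by
        push_cast; ring
      _ ≤ _ := by
        gcongr
        rw [add_assoc]
        exact le_self_add
  · calc ∫⁻ s in Set.Ioc (0 : ℝ) (2 / 3), g s * ENNReal.ofReal (betaDensity p s)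
        ≤ 3 * ∫⁻ s in Set.Ioc (0 : ℝ) (2 / 3), g s * ENNReal.ofReal (s ^ (1 / (p : ℝ) - 1)) := hr2
      _ = 3 * ((capConst p : ℝ≥0∞)⁻¹ * ∫⁻ z, g (‖z 0‖ ^ (2 * p)) ∂capMeasure p) := by
        rw [lintegral_capMeasure hp hg, ← mul_assoc (capConst p : ℝ≥0∞)⁻¹,
          ENNReal.inv_mul_cancel hk' ENNReal.coe_ne_top, one_mul]
      _ ≤ 3 * ((capConst p : ℝ≥0∞)⁻¹ *
          ∫⁻ z, g (‖z 0‖ ^ (2 * p)) ∂(C₂ • (eggSigma p).restrict (eggCap p))) := by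
        gcongr
      _ = ((3 * (capConst p)⁻¹ * C₂ : NNReal) : ℝ≥0∞) *
          ∫⁻ z in eggCap p, g (‖z 0‖ ^ (2 * p)) ∂eggSigma p := by
        rw [lintegral_smul_measure, ENNReal.coe_mul, ENNReal.coe_mul, ENNReal.coe_inv hk.ne',
          ENNReal.smul_def, smul_eq_mul, ENNReal.coe_ofNat]
        ring
      _ ≤ _ := by
        gcongr
        rw [add_comm (C₁ * capConst p), add_assoc]
        exact le_self_add

/-- The image of surface measure under `s = |z₁|^{2p}` is comparable to
`s^{1/p-1} (1-s)^{1/p-1} ds`. -/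
theorem lintegral_eggSigma_comparison (hp : 0 < p) :
    ∃ C : NNReal, C ≠ 0 ∧ ∀ g : ℝ → ℝ≥0∞, Measurable g →
    ∫⁻ z, g (‖z 0‖ ^ (2 * p)) ∂eggSigma p ≤
      C * ∫⁻ s in Set.Ioo (0 : ℝ) 1, g s * ENNReal.ofReal (betaDensity p s) ∧
    ∫⁻ s in Set.Ioo (0 : ℝ) 1, g s * ENNReal.ofReal (betaDensity p s) ≤
      C * ∫⁻ z, g (‖z 0‖ ^ (2 * p)) ∂eggSigma p := by
  obtain ⟨C, hC0, hC⟩ := lintegral_cap_comparison hp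
  -- The caps `|z₁|^{2p} ≤ 2/3` and `|z₂|^{2p} ≤ 2/3` cover the boundary and overlap, whence the
  -- factor `2`. The exchange of coordinates acts as `s ↦ 1 - s`, which preserves `betaDensity`; so
  -- the second cap follows from the first with `g (1 - s)`.
  refine ⟨2 * C, by positivity, fun g hg => ?_⟩
  have hg' : Measurable fun s => g (1 - s) := hg.comp (by fun_prop)
  obtain ⟨a1, a2⟩ := hC g hg
  obtain ⟨b1, b2⟩ := hC _ hg'
  have hflip : ∫⁻ s in Set.Ioc (0 : ℝ) (2 / 3), g (1 - s) * ENNReal.ofReal (betaDensity p s) =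
      ∫⁻ s in Set.Ico (1 / 3 : ℝ) 1, g s * ENNReal.ofReal (betaDensity p s) := by
    rw [← lintegral_indicator measurableSet_Ioc, ← lintegral_indicator measurableSet_Ico,
      ← lintegral_sub_left_eq_self ((Set.Ico (1 / 3 : ℝ) 1).indicator _) (1 : ℝ)]
    refine lintegral_congr fun s => ?_
    have : 1 - s ∈ Set.Ico (1 / 3 : ℝ) 1 ↔ s ∈ Set.Ioc (0 : ℝ) (2 / 3) := by
      simp only [Set.mem_Ico, Set.mem_Ioc]
      constructor <;> rintro ⟨h1, h2⟩ <;> constructor <;> linarith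
    by_cases hs : s ∈ Set.Ioc (0 : ℝ) (2 / 3)
    · rw [Set.indicator_of_mem hs, Set.indicator_of_mem (this.2 hs), betaDensity_one_sub]
    · rw [Set.indicator_of_notMem hs, Set.indicator_of_notMem fun h => hs (this.1 h)]
  have hcap' : MeasurableSet (swapIso ⁻¹' eggCap p) :=
    swapIso.continuous.measurable (measurableSet_eggCap p)
  have hswap : ∫⁻ z in eggCap p, g (1 - ‖z 0‖ ^ (2 * p)) ∂eggSigma p =
      ∫⁻ z in swapIso ⁻¹' eggCap p, g (‖z 0‖ ^ (2 * p)) ∂eggSigma p := by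
    have hm : Measurable fun z : C2 => g (1 - ‖z 0‖ ^ (2 * p)) :=
      hg'.comp (Continuous.measurable (by fun_prop))
    rw [← (measurePreserving_swapIso hp).setLIntegral_comp_preimage (measurableSet_eggCap p) hm]
    refine setLIntegral_congr_fun hcap' fun z hz => ?_
    have h1 : eggRho p (swapIso z) = 1 := by
      have := hz.1
      rwa [frontier_egg hp] at this
    have h2 : ‖z 1‖ ^ (2 * p) + ‖z 0‖ ^ (2 * p) = 1 := h1
    change g (1 - ‖z 1‖ ^ (2 * p)) = _
    congr 1
    linarith
  rw [hflip] at b1 b2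
  rw [hswap] at b1 b2
  have hae : ∀ᵐ z ∂eggSigma p, z ∈ frontier (egg p) := by
    rw [eggSigma, surfaceMeasure]
    exact ae_restrict_mem isClosed_frontier.measurableSet
  constructor
  · calc ∫⁻ z, g (‖z 0‖ ^ (2 * p)) ∂eggSigma p
        ≤ ∫⁻ z in eggCap p ∪ swapIso ⁻¹' eggCap p, g (‖z 0‖ ^ (2 * p)) ∂eggSigma p := by
          rw [← lintegral_indicator ((measurableSet_eggCap p).union hcap')]
          refine lintegral_mono_ae ?_
          filter_upwards [hae] with z hz
          rw [Set.indicator_of_mem]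
          have hz' := hz
          rw [frontier_egg hp] at hz'
          have hz' : ‖z 0‖ ^ (2 * p) + ‖z 1‖ ^ (2 * p) = 1 := hz'
          rcases le_total (‖z 0‖ ^ (2 * p)) (2 / 3) with h | h
          · exact Or.inl ⟨hz, h⟩
          · refine Or.inr ⟨?_, ?_⟩
            · rw [frontier_egg hp] at hz ⊢
              change ‖z 1‖ ^ (2 * p) + ‖z 0‖ ^ (2 * p) = 1
              linarith
            · rw [swapIso_zero]
              linarith
      _ ≤ ∫⁻ z in eggCap p, g (‖z 0‖ ^ (2 * p)) ∂eggSigma p +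
          ∫⁻ z in swapIso ⁻¹' eggCap p, g (‖z 0‖ ^ (2 * p)) ∂eggSigma p :=
        lintegral_union_le _ _ _
      _ ≤ C * (∫⁻ s in Set.Ioo (0 : ℝ) 1, g s * ENNReal.ofReal (betaDensity p s)) +
          C * (∫⁻ s in Set.Ioo (0 : ℝ) 1, g s * ENNReal.ofReal (betaDensity p s)) := by
        refine add_le_add (a1.trans ?_) (b1.trans ?_)
        · exact mul_le_mul_right (lintegral_mono_set
            (Set.Ioc_subset_Ioo_right (by norm_num))) _
        · exact mul_le_mul_right (lintegral_mono_set
            (Set.Ico_subset_Ioo_left (by norm_num))) _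
      _ = _ := by push_cast; ring
  · calc ∫⁻ s in Set.Ioo (0 : ℝ) 1, g s * ENNReal.ofReal (betaDensity p s)
        ≤ ∫⁻ s in Set.Ioc (0 : ℝ) (2 / 3) ∪ Set.Ico (1 / 3) 1,
            g s * ENNReal.ofReal (betaDensity p s) := by
          refine lintegral_mono_set (fun s hs => ?_)
          rcases le_total s (2 / 3) with h | h
          · exact Or.inl ⟨hs.1, h⟩
          · exact Or.inr ⟨by linarith, hs.2⟩
      _ ≤ _ := lintegral_union_le _ _ _
      _ ≤ C * (∫⁻ z, g (‖z 0‖ ^ (2 * p)) ∂eggSigma p) +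
          C * (∫⁻ z, g (‖z 0‖ ^ (2 * p)) ∂eggSigma p) := by
        refine add_le_add (a2.trans ?_) (b2.trans ?_) <;>
        · gcongr
          exact Measure.restrict_le_self
      _ = _ := by push_cast; ring

end

noncomputable section

/-- The real-linear `j`-th coordinate. -/
def coordR (j : Fin 2) : C2 →L[ℝ] ℂ := (EuclideanSpace.proj j : C2 →L[ℂ] ℂ).restrictScalars ℝ

theorem coordR_apply (j : Fin 2) (z : C2) : coordR j z = z j := rfl

/-! ### The forms `dᶜφ` and `ddᶜφ` -/

theorem dc_apply (φ : C2 → ℝ) (z u : C2) : dc φ z ![u] = -fderiv ℝ φ z (Complex.I • u) := rfl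

theorem differentiableAt_dc {φ : C2 → ℝ} {z : C2} (h : DifferentiableAt ℝ (fderiv ℝ φ) z) :
    DifferentiableAt ℝ (dc φ) z := by
  -- `dᶜφ` is a fixed linear function of `dφ`, continuous because the space is finite-dimensional.
  let L : (C2 →L[ℝ] ℝ) →ₗ[ℝ] (C2 [⋀^Fin 1]→L[ℝ] ℝ) :=
    { toFun := fun f => ContinuousAlternatingMap.ofSubsingleton ℝ C2 ℝ 0
        (-f.comp ((Complex.I • ContinuousLinearMap.id ℂ C2).restrictScalars ℝ))
      map_add' := fun f g => by
        ext v
        simp [add_comm]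
      map_smul' := fun c f => by
        ext v
        simp }
  exact (LinearMap.toContinuousLinearMap L).differentiableAt.comp z h

theorem ddc_apply {φ : C2 → ℝ} {z : C2} (h : DifferentiableAt ℝ (fderiv ℝ φ) z) (u v : C2) :
    ddc φ z ![u, v] = fderiv ℝ (fun x => fderiv ℝ φ x (Complex.I • u)) z v -
      fderiv ℝ (fun x => fderiv ℝ φ x (Complex.I • v)) z u := by
  rw [ddc, extDeriv_apply (differentiableAt_dc h), Fin.sum_univ_two]
  have h0 : (0 : Fin 2).removeNth ![u, v] = ![v] := by
    ext i; fin_cases i; rfl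
  have h1 : (1 : Fin 2).removeNth ![u, v] = ![u] := by
    ext i; fin_cases i; rfl
  simp only [h0, h1, dc_apply, fderiv_fun_neg]
  simp
  ring

/-- The Levi form along `m` is the Laplacian of `φ` on the complex line spanned by `m`. -/
theorem ddc_apply_I_smul {φ : C2 → ℝ} {z : C2} (h : DifferentiableAt ℝ (fderiv ℝ φ) z) (m : C2) :
    ddc φ z ![m, Complex.I • m] = fderiv ℝ (fun x => fderiv ℝ φ x m) z m +
      fderiv ℝ (fun x => fderiv ℝ φ x (Complex.I • m)) z (Complex.I • m) := by
  rw [ddc_apply h]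
  simp only [smul_smul, Complex.I_mul_I, neg_smul, one_smul, map_neg, fderiv_fun_neg]
  simp
  ring

/-! ### Derivatives of the exhaustion function of the egg -/

variable {p : ℕ}

theorem hasFDerivAt_norm_coord_pow (j : Fin 2) (n : ℕ) (z : C2) :
    HasFDerivAt (fun x : C2 => ‖x j‖ ^ (2 * n))
      ((n * ‖z j‖ ^ (2 * (n - 1)) * 2) • (innerSL ℝ (z j)).comp (coordR j)) z := by
  have h := ((coordR j).hasFDerivAt (x := z)).norm_sq.pow n
  simp only [coordR_apply, ← pow_mul] at h
  refine h.congr_fderiv ?_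
  ext v
  simp only [smul_apply, smul_eq_mul, nsmul_eq_mul, Nat.cast_ofNat]
  ring

/-- The numerator `∑ⱼ |zⱼ|^{2(p-1)} Re (z̄ⱼ uⱼ)` of `dφ(u)`. -/
def eggNum (p : ℕ) (u z : C2) : ℝ :=
  ‖z 0‖ ^ (2 * (p - 1)) * inner ℝ (z 0) (u 0) + ‖z 1‖ ^ (2 * (p - 1)) * inner ℝ (z 1) (u 1)

theorem fderiv_eggExhaustion (hp : 0 < p) {z : C2} (hz : eggRho p z ≠ 0) (u : C2) :
    fderiv ℝ (eggExhaustion p) z u = (eggRho p z)⁻¹ * eggNum p u z := by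
  have hp' : (p : ℝ) ≠ 0 := by exact_mod_cast hp.ne'
  have h := (((hasFDerivAt_norm_coord_pow 0 p z).add (hasFDerivAt_norm_coord_pow 1 p z)).log
    hz).const_mul (1 / (2 * p : ℝ))
  have h2 : HasFDerivAt (eggExhaustion p) _ z := h
  rw [h2.fderiv]
  simp only [eggNum, eggRho, coordR_apply, smul_apply,
    add_apply, ContinuousLinearMap.comp_apply, innerSL_apply_apply,
    smul_eq_mul, Pi.add_apply]
  field_simp

theorem contDiffAt_eggExhaustion {z : C2} (hz : eggRho p z ≠ 0) :
    ContDiffAt ℝ 2 (eggExhaustion p) z := by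
  have h : ∀ j : Fin 2, ContDiff ℝ 2 fun x : C2 => ‖x j‖ ^ (2 * p) := fun j => by
    simp only [pow_mul]
    exact ((contDiff_norm_sq ℝ).comp (coordR j).contDiff).pow p
  exact contDiffAt_const.mul (((h 0).add (h 1)).contDiffAt.log hz)

theorem differentiableAt_fderiv_eggExhaustion {z : C2} (hz : eggRho p z ≠ 0) :
    DifferentiableAt ℝ (fderiv ℝ (eggExhaustion p)) z :=
  ((contDiffAt_eggExhaustion hz).fderiv_right (m := 1) (by norm_num)).differentiableAt
    (by norm_num)

theorem hasFDerivAt_eggNum (u z : C2) : HasFDerivAt (eggNum p u)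
    (‖z 0‖ ^ (2 * (p - 1)) • (innerSL ℝ (u 0)).comp (coordR 0) +
      (inner ℝ (z 0) (u 0)) • ((((p - 1 : ℕ) : ℝ) * ‖z 0‖ ^ (2 * (p - 1 - 1)) * 2) •
        (innerSL ℝ (z 0)).comp (coordR 0)) +
    (‖z 1‖ ^ (2 * (p - 1)) • (innerSL ℝ (u 1)).comp (coordR 1) +
      (inner ℝ (z 1) (u 1)) • ((((p - 1 : ℕ) : ℝ) * ‖z 1‖ ^ (2 * (p - 1 - 1)) * 2) •
        (innerSL ℝ (z 1)).comp (coordR 1)))) z := by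
  have hl : ∀ j : Fin 2, HasFDerivAt (fun x : C2 => inner ℝ (x j) (u j))
      ((innerSL ℝ (u j)).comp (coordR j)) z := fun j => by
    have := ((innerSL ℝ (u j)).comp (coordR j)).hasFDerivAt (x := z)
    refine this.congr_of_eventuallyEq (Eventually.of_forall fun x => ?_)
    simp only [ContinuousLinearMap.comp_apply, innerSL_apply_apply, coordR_apply]
    exact real_inner_comm _ _
  exact ((hasFDerivAt_norm_coord_pow 0 (p - 1) z).mul (hl 0)).add
    ((hasFDerivAt_norm_coord_pow 1 (p - 1) z).mul (hl 1))

/-- As `dφ(u) = 0` at `z`, differentiating the factor `1/ρ` contributes nothing, and `ρ = 1` removes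
the factor itself. -/
theorem fderiv_fderiv_eggExhaustion (hp : 0 < p) {z : C2} (hz : eggRho p z = 1) {u : C2}
    (hu : eggNum p u z = 0) :
    fderiv ℝ (fun x => fderiv ℝ (eggExhaustion p) x u) z u =
      ‖z 0‖ ^ (2 * (p - 1)) * ‖u 0‖ ^ 2 +
        2 * ((p - 1 : ℕ) : ℝ) * ‖z 0‖ ^ (2 * (p - 1 - 1)) * inner ℝ (z 0) (u 0) ^ 2 +
      (‖z 1‖ ^ (2 * (p - 1)) * ‖u 1‖ ^ 2 +
        2 * ((p - 1 : ℕ) : ℝ) * ‖z 1‖ ^ (2 * (p - 1 - 1)) * inner ℝ (z 1) (u 1) ^ 2) := by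
  have hne : eggRho p z ≠ 0 := by rw [hz]; exact one_ne_zero
  have hev : (fun x => fderiv ℝ (eggExhaustion p) x u) =ᶠ[𝓝 z]
      fun x => (eggRho p x)⁻¹ * eggNum p u x := by
    filter_upwards [(continuous_eggRho p).continuousAt.eventually_ne hne] with x hx
    exact fderiv_eggExhaustion hp hx u
  rw [hev.fderiv_eq]
  have hρ : DifferentiableAt ℝ (fun x => (eggRho p x)⁻¹) z :=
    (((hasFDerivAt_norm_coord_pow 0 p z).add (hasFDerivAt_norm_coord_pow 1 p z)).differentiableAt).inv
      hne
  have hN := hasFDerivAt_eggNum (p := p) u z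
  have hmul : HasFDerivAt (fun x => (eggRho p x)⁻¹ * eggNum p u x) _ z := hρ.hasFDerivAt.mul hN
  rw [hmul.fderiv]
  simp only [smul_apply, add_apply,
    ContinuousLinearMap.comp_apply, innerSL_apply_apply, smul_eq_mul, coordR_apply, hu, hz,
    real_inner_self_eq_norm_sq]
  ring

theorem inner_sq_add_inner_I_smul_sq (a b : ℂ) :
    (inner ℝ a b : ℝ) ^ 2 + (inner ℝ a (Complex.I • b) : ℝ) ^ 2 = ‖a‖ ^ 2 * ‖b‖ ^ 2 := by
  rw [← Complex.normSq_eq_norm_sq, ← Complex.normSq_eq_norm_sq, Complex.inner, Complex.inner,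
    Complex.normSq_apply, Complex.normSq_apply]
  simp
  ring

/-- The directions `m` and `i m` contribute `2`, and the radial terms add up to `2(p-1)` by
`inner_sq_add_inner_I_smul_sq`; the total is `2p`. -/
theorem levi_eggExhaustion (hp : 0 < p) {z : C2} (hz : eggRho p z = 1) {m : C2}
    (hm : eggNum p m z = 0) (hm' : eggNum p (Complex.I • m) z = 0) :
    ddc (eggExhaustion p) z ![m, Complex.I • m] =
      2 * p * (‖z 0‖ ^ (2 * (p - 1)) * ‖m 0‖ ^ 2 + ‖z 1‖ ^ (2 * (p - 1)) * ‖m 1‖ ^ 2) := by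
  have hne : eggRho p z ≠ 0 := by rw [hz]; exact one_ne_zero
  rw [ddc_apply_I_smul (differentiableAt_fderiv_eggExhaustion hne),
    fderiv_fderiv_eggExhaustion hp hz hm, fderiv_fderiv_eggExhaustion hp hz hm']
  have e0 := inner_sq_add_inner_I_smul_sq (z 0) (m 0)
  have e1 := inner_sq_add_inner_I_smul_sq (z 1) (m 1)
  have n0 : ‖(Complex.I • m) 0‖ = ‖m 0‖ := by simp
  have n1 : ‖(Complex.I • m) 1‖ = ‖m 1‖ := by simp
  have i0 : (Complex.I • m) 0 = Complex.I • m 0 := rfl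
  have i1 : (Complex.I • m) 1 = Complex.I • m 1 := rfl
  rw [n0, n1, i0, i1]
  obtain ⟨q, rfl⟩ : ∃ q, p = q + 1 := ⟨p - 1, by omega⟩
  simp only [Nat.add_sub_cancel]
  -- For `p = 1` the truncated exponent `p - 1 - 1` is meaningless, but its term has coefficient `p
  -- - 1 = 0`.
  rcases q with _ | q
  · simp
    ring
  · simp only [Nat.add_sub_cancel]
    have f0 : ‖z 0‖ ^ (2 * (q + 1)) = ‖z 0‖ ^ (2 * q) * ‖z 0‖ ^ 2 := by ring
    have f1 : ‖z 1‖ ^ (2 * (q + 1)) = ‖z 1‖ ^ (2 * q) * ‖z 1‖ ^ 2 := by ring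
    rw [f0, f1]
    push_cast
    linear_combination 2 * ((q : ℝ) + 1) * ‖z 0‖ ^ (2 * q) * e0 +
      2 * ((q : ℝ) + 1) * ‖z 1‖ ^ (2 * q) * e1

/-- The value of the Monge–Ampère density of `φₚ` with respect to surface area on `b𝓔ₚ`. -/
def eggDensity (p : ℕ) (z : C2) : ℝ :=
  2 * p * (‖z 0‖ * ‖z 1‖) ^ (2 * (p - 1)) /
    √((‖z 0‖ ^ (2 * (p - 1)) * ‖z 0‖) ^ 2 + (‖z 1‖ ^ (2 * (p - 1)) * ‖z 1‖) ^ 2)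

theorem realGrad_eggExhaustion (hp : 0 < p) {z : C2} (hz : eggRho p z = 1) (j : Fin 2) :
    realGrad (eggExhaustion p) z j = ((‖z j‖ ^ (2 * (p - 1)) : ℝ) : ℂ) * z j := by
  have hne : eggRho p z ≠ 0 := by rw [hz]; exact one_ne_zero
  simp only [realGrad, fderiv_eggExhaustion hp hne, hz, eggNum]
  apply Complex.ext <;> fin_cases j <;>
    simp [Complex.inner, -Complex.ofReal_pow]

theorem eggNum_eq_inner_grad {g : C2} {z : C2}
    (hg : ∀ j, g j = ((‖z j‖ ^ (2 * (p - 1)) : ℝ) : ℂ) * z j) (u : C2) :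
    eggNum p u z = inner ℝ (g 0) (u 0) + inner ℝ (g 1) (u 1) := by
  rw [eggNum, hg 0, hg 1, ← Complex.real_smul, ← Complex.real_smul, real_inner_smul_left,
    real_inner_smul_left]

/-- Bounds for the squared length of `∇φₚ`. As `|zⱼ| ≤ 1`, `|zⱼ|^{2p-1} ≥ |zⱼ|^{2p}`, and two
numbers with sum `1` have squares adding to at least `1/2`. -/
theorem half_sq_le_grad (hp : 0 < p) {z : C2} (hz : eggRho p z = 1) :
    1 / 4 ≤ (‖z 0‖ ^ (2 * (p - 1)) * ‖z 0‖) ^ 2 + (‖z 1‖ ^ (2 * (p - 1)) * ‖z 1‖) ^ 2 ∧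
    (‖z 0‖ ^ (2 * (p - 1)) * ‖z 0‖) ^ 2 + (‖z 1‖ ^ (2 * (p - 1)) * ‖z 1‖) ^ 2 ≤ 2 := by
  have key : ∀ j : Fin 2, ‖z j‖ ^ (2 * p) ≤ ‖z j‖ ^ (2 * (p - 1)) * ‖z j‖ ∧
      ‖z j‖ ^ (2 * (p - 1)) * ‖z j‖ ≤ 1 := fun j => by
    have h1 := norm_le_one_of_eggRho_le hp hz.le j
    constructor
    · rw [← pow_succ]
      exact pow_le_pow_of_le_one (norm_nonneg _) h1 (by omega)
    · rw [← pow_succ]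
      exact pow_le_one₀ (norm_nonneg _) h1
  have hsum : ‖z 0‖ ^ (2 * p) + ‖z 1‖ ^ (2 * p) = 1 := hz
  obtain ⟨a0, b0⟩ := key 0
  obtain ⟨a1, b1⟩ := key 1
  have c0 : 0 ≤ ‖z 0‖ ^ (2 * p) := by positivity
  have c1 : 0 ≤ ‖z 1‖ ^ (2 * p) := by positivity
  constructor
  · nlinarith [sq_nonneg (‖z 0‖ ^ (2 * (p - 1)) * ‖z 0‖ - ‖z 1‖ ^ (2 * (p - 1)) * ‖z 1‖)]
  · nlinarith

/-- Both `m` and `i m` are annihilated by `dφ`, so `dᶜφ` vanishes on them and only `dᶜφ(i n) ·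
ddᶜφ(m, i m)` survives. The first factor is `|∇φ|`. In the second, `|m₁| = |n₂|` and `|m₂| = |n₁|`
produce `|z₁ z₂|^{2(p-1)} (|z₁|^{2p} + |z₂|^{2p})`, whose last factor is `1`. -/
theorem dcWedgeDdc_eggExhaustion (hp : 0 < p) {z : C2} (hz : eggRho p z = 1) :
    dcWedgeDdc (eggExhaustion p) z (Complex.I • unitNormal (eggExhaustion p) z)
      (complexTangent (unitNormal (eggExhaustion p) z))
      (Complex.I • complexTangent (unitNormal (eggExhaustion p) z)) = eggDensity p z := by
  have hne : eggRho p z ≠ 0 := by rw [hz]; exact one_ne_zero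
  set φ := eggExhaustion p with hφ
  set g := realGrad φ z with hgdef
  set n := unitNormal φ z with hn
  set m := complexTangent n with hmdef
  have hg : ∀ j, g j = ((‖z j‖ ^ (2 * (p - 1)) : ℝ) : ℂ) * z j := realGrad_eggExhaustion hp hz
  have hgn : ∀ j, ‖g j‖ = ‖z j‖ ^ (2 * (p - 1)) * ‖z j‖ := fun j => by
    rw [hg j, norm_mul, Complex.norm_real, Real.norm_of_nonneg (by positivity)]
  set G := ‖g‖ with hG
  have hG2 : G ^ 2 = ‖g 0‖ ^ 2 + ‖g 1‖ ^ 2 := by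
    rw [hG, EuclideanSpace.norm_sq_eq, Fin.sum_univ_two]
  have hGs : G = √((‖z 0‖ ^ (2 * (p - 1)) * ‖z 0‖) ^ 2 + (‖z 1‖ ^ (2 * (p - 1)) * ‖z 1‖) ^ 2) := by
    rw [hG, EuclideanSpace.norm_eq, Fin.sum_univ_two, hgn, hgn]
  have hG0 : 0 < G := by
    rw [hGs]
    exact Real.sqrt_pos.2 (by linarith [(half_sq_le_grad hp hz).1])
  have hnj : ∀ j, n j = (G⁻¹ : ℝ) • g j := fun j => rfl
  have hgnj : ∀ j, g j = (G : ℝ) • n j := fun j => by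
    rw [hnj, smul_smul, mul_inv_cancel₀ hG0.ne', one_smul]
  have m0 : m 0 = -(starRingEnd ℂ) (n 1) := rfl
  have m1 : m 1 = (starRingEnd ℂ) (n 0) := rfl
  have hNm : eggNum p m z = 0 := by
    rw [eggNum_eq_inner_grad hg, hgnj 0, hgnj 1, m0, m1]
    simp only [Complex.inner]
    simp
    ring
  have hNIm : eggNum p (Complex.I • m) z = 0 := by
    have i0 : (Complex.I • m) 0 = Complex.I * m 0 := rfl
    have i1 : (Complex.I • m) 1 = Complex.I * m 1 := rfl
    rw [eggNum_eq_inner_grad hg, hgnj 0, hgnj 1, i0, i1, m0, m1]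
    simp only [Complex.inner]
    simp
    ring
  have hNn : eggNum p n z = G := by
    rw [eggNum_eq_inner_grad hg, hnj 0, hnj 1, real_inner_smul_right, real_inner_smul_right,
      real_inner_self_eq_norm_sq, real_inner_self_eq_norm_sq, ← mul_add, ← hG2]
    field_simp
  have hII : ∀ v : C2, Complex.I • Complex.I • v = -v := fun v => by
    rw [smul_smul, Complex.I_mul_I, neg_smul, one_smul]
  have d1 : dc φ z ![Complex.I • n] = G := by
    rw [dc_apply, hII, map_neg, neg_neg, fderiv_eggExhaustion hp hne, hz, hNn]
    simp
  have d2 : dc φ z ![m] = 0 := by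
    rw [dc_apply, fderiv_eggExhaustion hp hne, hNIm]
    simp
  have d3 : dc φ z ![Complex.I • m] = 0 := by
    rw [dc_apply, hII, map_neg, neg_neg, fderiv_eggExhaustion hp hne, hNm]
    simp
  rw [dcWedgeDdc, d1, d2, d3, levi_eggExhaustion hp hz hNm hNIm]
  have k0 : ‖m 0‖ ^ 2 = (G ^ 2)⁻¹ * ‖g 1‖ ^ 2 := by
    rw [m0, norm_neg, RCLike.norm_conj, hnj 1, norm_smul, Real.norm_of_nonneg (by positivity)]
    ring
  have k1 : ‖m 1‖ ^ 2 = (G ^ 2)⁻¹ * ‖g 0‖ ^ 2 := by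
    rw [m1, RCLike.norm_conj, hnj 0, norm_smul, Real.norm_of_nonneg (by positivity)]
    ring
  rw [k0, k1, hgn, hgn, eggDensity, ← hGs]
  have hsum : ‖z 0‖ ^ (2 * p) + ‖z 1‖ ^ (2 * p) = 1 := hz
  obtain ⟨q, rfl⟩ : ∃ q, p = q + 1 := ⟨p - 1, by omega⟩
  simp only [Nat.add_sub_cancel] at *
  have hs' : ‖z 0‖ ^ (2 * q) * ‖z 0‖ ^ 2 + ‖z 1‖ ^ (2 * q) * ‖z 1‖ ^ 2 = 1 := by
    rw [← hsum]; ring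
  field_simp
  rw [mul_pow]
  linear_combination (2 * (‖z 0‖ ^ (2 * q) * ‖z 1‖ ^ (2 * q)) * ((q + 1 : ℕ) : ℝ)) * hs'

theorem eggDensity_bounds (hp : 0 < p) {z : C2} (hz : eggRho p z = 1) :
    p * (‖z 0‖ * ‖z 1‖) ^ (2 * (p - 1)) ≤ eggDensity p z ∧
      eggDensity p z ≤ 4 * p * (‖z 0‖ * ‖z 1‖) ^ (2 * (p - 1)) := by
  obtain ⟨h1, h2⟩ := half_sq_le_grad hp hz
  unfold eggDensity
  set X := (‖z 0‖ ^ (2 * (p - 1)) * ‖z 0‖) ^ 2 + (‖z 1‖ ^ (2 * (p - 1)) * ‖z 1‖) ^ 2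
  have a1 : 1 / 2 ≤ √X := Real.le_sqrt_of_sq_le (by norm_num; linarith)
  have a2 : √X ≤ 2 := Real.sqrt_le_iff.2 ⟨by norm_num, by linarith⟩
  have hT : 0 ≤ p * (‖z 0‖ * ‖z 1‖) ^ (2 * (p - 1)) := by positivity
  constructor
  · rw [le_div_iff₀ (by linarith)]
    nlinarith
  · rw [div_le_iff₀ (by linarith)]
    nlinarith

end

noncomputable section

variable {p : ℕ}

/-! ### The beta function -/

theorem integrableOn_beta {x y : ℝ} (hx : 0 < x) (hy : 0 < y) :
    IntegrableOn (fun s : ℝ => s ^ (x - 1) * (1 - s) ^ (y - 1)) (Set.Ioo 0 1) := by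
  have h := (Complex.betaIntegral_convergent (u := x) (v := y) (by simpa using hx)
    (by simpa using hy)).norm
  rw [intervalIntegrable_iff_integrableOn_Ioo_of_le zero_le_one] at h
  refine h.congr_fun (fun s hs => ?_) measurableSet_Ioo
  have h1 : (0 : ℝ) < 1 - s := by linarith [hs.2]
  have e1 : ‖(s : ℂ) ^ ((x : ℂ) - 1)‖ = s ^ (x - 1) := by
    rw [Complex.norm_cpow_eq_rpow_re_of_pos hs.1]; simp
  have e2 : ‖(1 - (s : ℂ)) ^ ((y : ℂ) - 1)‖ = (1 - s) ^ (y - 1) := by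
    have : (1 - (s : ℂ)) = ((1 - s : ℝ) : ℂ) := by push_cast; rfl
    rw [this, Complex.norm_cpow_eq_rpow_re_of_pos h1]; simp
  simp only [norm_mul, e1, e2]

theorem eulerBeta_eq_setIntegral (x y : ℝ) :
    eulerBeta x y = ∫ s in Set.Ioo (0 : ℝ) 1, s ^ (x - 1) * (1 - s) ^ (y - 1) := by
  rw [eulerBeta, intervalIntegral.integral_of_le zero_le_one, integral_Ioc_eq_integral_Ioo]

theorem lintegral_beta {x y : ℝ} (hx : 0 < x) (hy : 0 < y) :
    ∫⁻ s in Set.Ioo (0 : ℝ) 1, ENNReal.ofReal (s ^ (x - 1) * (1 - s) ^ (y - 1)) =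
      ENNReal.ofReal (eulerBeta x y) := by
  rw [eulerBeta_eq_setIntegral, ofReal_integral_eq_lintegral_ofReal (integrableOn_beta hx hy)]
  refine (ae_restrict_mem measurableSet_Ioo).mono fun s hs => ?_
  have h1 : (0 : ℝ) < 1 - s := by linarith [hs.2]
  have := hs.1
  positivity

theorem eulerBeta_pos {x y : ℝ} (hx : 0 < x) (hy : 0 < y) : 0 < eulerBeta x y := by
  rw [eulerBeta_eq_setIntegral, setIntegral_pos_iff_support_of_nonneg_ae
    ((ae_restrict_mem measurableSet_Ioo).mono fun s hs => ?_) (integrableOn_beta hx hy)]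
  · have : Set.Ioo (0 : ℝ) 1 ⊆
        (Function.support fun s : ℝ => s ^ (x - 1) * (1 - s) ^ (y - 1)) ∩ Set.Ioo 0 1 := by
      intro s hs
      have h1 : (0 : ℝ) < 1 - s := by linarith [hs.2]
      have := hs.1
      refine ⟨?_, hs⟩
      rw [Function.mem_support]
      positivity
    refine lt_of_lt_of_le ?_ (measure_mono this)
    simp
  · have h1 : (0 : ℝ) < 1 - s := by linarith [hs.2]
    have := hs.1
    positivity

/-! ### The measures `σ` and `ωₚ` -/

theorem ae_eggSigma_mem_frontier (p : ℕ) : ∀ᵐ z ∂eggSigma p, z ∈ frontier (egg p) := by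
  rw [eggSigma, surfaceMeasure]
  exact ae_restrict_mem isClosed_frontier.measurableSet

theorem ae_eggSigma_eggRho (hp : 0 < p) : ∀ᵐ z ∂eggSigma p, eggRho p z = 1 := by
  filter_upwards [ae_eggSigma_mem_frontier p] with z hz
  rwa [frontier_egg hp] at hz

theorem measurable_eggDensity (p : ℕ) : Measurable (eggDensity p) := by
  unfold eggDensity
  have h : ∀ j : Fin 2, Measurable fun z : C2 => ‖z j‖ := fun j =>
    Continuous.measurable (by fun_prop)
  have h0 := h 0
  have h1 := h 1
  fun_prop

theorem eggOmega_eq (hp : 0 < p) :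
    eggOmega p = (eggSigma p).withDensity fun z => ENNReal.ofReal (eggDensity p z) := by
  rw [eggOmega, mongeAmpereMeasure]
  refine withDensity_congr_ae ?_
  filter_upwards [ae_eggSigma_eggRho hp] with z hz
  rw [dcWedgeDdc_eggExhaustion hp hz]

theorem eggDensity_le (hp : 0 < p) {z : C2} (hz : eggRho p z = 1) : eggDensity p z ≤ 4 * p := by
  refine (eggDensity_bounds hp hz).2.trans ?_
  have h0 := norm_le_one_of_eggRho_le hp hz.le 0
  have h1 := norm_le_one_of_eggRho_le hp hz.le 1
  have : (‖z 0‖ * ‖z 1‖) ^ (2 * (p - 1)) ≤ 1 :=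
    pow_le_one₀ (by positivity) (mul_le_one₀ h0 (norm_nonneg _) h1)
  exact mul_le_of_le_one_right (by positivity) this

theorem eggOmega_le (hp : 0 < p) : eggOmega p ≤ (4 * p : ℝ≥0∞) • eggSigma p := by
  rw [eggOmega_eq hp, ← withDensity_const]
  refine withDensity_mono ?_
  filter_upwards [ae_eggSigma_eggRho hp] with z hz
  refine (ENNReal.ofReal_le_ofReal (eggDensity_le hp hz)).trans (le_of_eq ?_)
  rw [ENNReal.ofReal_mul (by norm_num)]
  simp

theorem eggSigma_one_le : eggSigma 1 ≤ eggOmega 1 := by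
  rw [eggOmega_eq one_pos]
  nth_rewrite 1 [← withDensity_one (μ := eggSigma 1)]
  refine withDensity_mono ?_
  filter_upwards [ae_eggSigma_eggRho one_pos] with z hz
  have := (eggDensity_bounds one_pos hz).1
  simp only [Nat.cast_one, Nat.sub_self, mul_zero, pow_zero, mul_one] at this
  simpa using ENNReal.ofReal_le_ofReal this

/-- The image of `σ` under `s` is dominated by a measure with a density, so each level of `s` is
null; the axes are the levels `0` and `1`. -/
theorem ae_eggSigma_coord_ne_zero (hp : 0 < p) : ∀ᵐ z ∂eggSigma p, z 0 ≠ 0 ∧ z 1 ≠ 0 := by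
  obtain ⟨C, -, hC⟩ := lintegral_eggSigma_comparison hp
  have key : ∀ t : ℝ, ∀ᵐ z ∂eggSigma p, ‖z 0‖ ^ (2 * p) ≠ t := fun t => by
    have h := (hC (({t} : Set ℝ).indicator 1) (measurable_one.indicator
      (measurableSet_singleton t))).1
    have h0 : ∫⁻ s in Set.Ioo (0 : ℝ) 1, ({t} : Set ℝ).indicator 1 s *
        ENNReal.ofReal (betaDensity p s) = 0 := by
      have hm : Measurable fun s => ({t} : Set ℝ).indicator (1 : ℝ → ℝ≥0∞) s *
          ENNReal.ofReal (betaDensity p s) :=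
        (measurable_one.indicator (measurableSet_singleton t)).mul
          (measurable_betaDensity p).ennreal_ofReal
      rw [lintegral_eq_zero_iff hm]
      refine ae_restrict_of_ae ?_
      filter_upwards [Measure.ae_ne volume t] with s hs
      simp [hs]
    rw [h0, mul_zero] at h
    have hm : Measurable fun z : C2 => ({t} : Set ℝ).indicator (1 : ℝ → ℝ≥0∞) (‖z 0‖ ^ (2 * p)) :=
      (measurable_one.indicator (measurableSet_singleton t)).comp
        (Continuous.measurable (by fun_prop))
    have h1 := (lintegral_eq_zero_iff hm).1 (le_antisymm h (zero_le))
    filter_upwards [h1] with z hz ht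
    simp [ht] at hz
  filter_upwards [key 0, key 1, ae_eggSigma_eggRho hp] with z h0 h1 hz
  have hz' : ‖z 0‖ ^ (2 * p) + ‖z 1‖ ^ (2 * p) = 1 := hz
  refine ⟨fun h => h0 ?_, fun h => h1 ?_⟩
  · rw [h, norm_zero, zero_pow (by omega)]
  · rw [h, norm_zero, zero_pow (by omega)] at hz'
    linarith

theorem eggOmega_absolutelyContinuous (hp : 0 < p) : eggOmega p ≪ eggSigma p := by
  rw [eggOmega_eq hp]
  exact withDensity_absolutelyContinuous _ _

/-- The density of `ωₚ` vanishes at most on the axes, which are `σ`-null. -/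
theorem eggSigma_absolutelyContinuous (hp : 0 < p) : eggSigma p ≪ eggOmega p := by
  have hp' : (0 : ℝ) < p := by exact_mod_cast hp
  rw [eggOmega_eq hp]
  refine withDensity_absolutelyContinuous' (measurable_eggDensity p).ennreal_ofReal.aemeasurable ?_
  filter_upwards [ae_eggSigma_eggRho hp, ae_eggSigma_coord_ne_zero hp] with z hz hne
  have h0 := norm_pos_iff.2 hne.1
  have h1 := norm_pos_iff.2 hne.2
  have := (eggDensity_bounds hp hz).1
  have h2 : 0 < p * (‖z 0‖ * ‖z 1‖) ^ (2 * (p - 1)) := by positivity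
  simpa using lt_of_lt_of_le h2 this

theorem support_eggSigma (hp : 0 < p) : (eggSigma p).support = frontier (egg p) := by
  apply Set.Subset.antisymm
  · exact Measure.support_subset_of_isClosed isClosed_frontier (ae_eggSigma_mem_frontier p)
  · intro z hz
    rw [Measure.mem_support_iff_forall]
    intro U hU
    rcases lt_or_ge (‖z 0‖ ^ (2 * p)) (2 / 3) with h | h
    · exact eggSigma_pos_of_mem_nhds hp hz h hU
    · have hz' := hz
      rw [frontier_egg hp] at hz'
      have hz'' : ‖z 0‖ ^ (2 * p) + ‖z 1‖ ^ (2 * p) = 1 := hz'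
      have hss : swapIso (swapIso z) = z := by
        ext i; fin_cases i <;> rfl
      have hU' : swapIso ⁻¹' U ∈ 𝓝 (swapIso z) :=
        swapIso.continuous.continuousAt.preimage_mem_nhds (by rwa [hss])
      have hzs : swapIso z ∈ frontier (egg p) := by
        rw [frontier_egg hp]
        change ‖z 1‖ ^ (2 * p) + ‖z 0‖ ^ (2 * p) = 1
        linarith
      have := eggSigma_pos_of_mem_nhds hp hzs (by rw [swapIso_zero]; linarith) hU'
      rwa [(measurePreserving_swapIso hp).measure_preimage_emb
        swapIso.toHomeomorph.measurableEmbedding] at this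

theorem support_eggOmega (hp : 0 < p) : (eggOmega p).support = frontier (egg p) := by
  rw [← support_eggSigma hp]
  exact Set.Subset.antisymm (eggOmega_absolutelyContinuous hp).support_mono
    (eggSigma_absolutelyContinuous hp).support_mono

/-! ### Orthogonality of the monomials -/

theorem coordMonomial_torusIso (u : Fin 2 → Circle) (x : ℕ × ℕ) (z : C2) :
    coordMonomial x (torusIso u z) = (u 0 : ℂ) ^ x.1 * (u 1 : ℂ) ^ x.2 * coordMonomial x z := by
  simp only [coordMonomial, torusIso_apply, mul_pow]
  ring

/-- The angle `π/(m-n)` is chosen so that the total phase is `e^{iπ}`. -/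
theorem circle_exp_pow_mul_conj_pow {m n : ℕ} (h : m ≠ n) :
    (Circle.exp (Real.pi / ((m : ℝ) - n)) : ℂ) ^ m *
      (starRingEnd ℂ) ((Circle.exp (Real.pi / ((m : ℝ) - n)) : ℂ) ^ n) = -1 := by
  have hne : (m : ℂ) - n ≠ 0 := sub_ne_zero.2 (by exact_mod_cast h)
  rw [Circle.coe_exp, map_pow, ← Complex.exp_conj, ← Complex.exp_nat_mul, ← Complex.exp_nat_mul,
    ← Complex.exp_add, ← Complex.exp_pi_mul_I]
  congr 1
  rw [map_mul, Complex.conj_ofReal, Complex.conj_I]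
  push_cast
  field_simp
  ring

/-- One rotation in a coordinate where the exponents differ changes the sign of the integrand but
not the integral. -/
theorem integral_inner_coordMonomial_eq_zero {ν : Measure C2}
    (hν : ∀ u, MeasurePreserving (torusIso u) ν ν) {x y : ℕ × ℕ} (hxy : x ≠ y) :
    ∫ z, inner ℂ (coordMonomial x z) (coordMonomial y z) ∂ν = 0 := by
  have key : ∀ u : Fin 2 → Circle, (u 0 : ℂ) ^ y.1 * (u 1 : ℂ) ^ y.2 *
      (starRingEnd ℂ) ((u 0 : ℂ) ^ x.1 * (u 1 : ℂ) ^ x.2) = -1 →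
      ∫ z, inner ℂ (coordMonomial x z) (coordMonomial y z) ∂ν = 0 := by
    intro u hu
    have h := (hν u).integral_comp (torusIso u).toHomeomorph.measurableEmbedding
      (fun z => inner ℂ (coordMonomial x z) (coordMonomial y z))
    have h2 : ∀ z, inner ℂ (coordMonomial x (torusIso u z)) (coordMonomial y (torusIso u z)) =
        -1 * inner ℂ (coordMonomial x z) (coordMonomial y z) := fun z => by
      rw [← hu, coordMonomial_torusIso, coordMonomial_torusIso, RCLike.inner_apply,
        RCLike.inner_apply, map_mul]
      ring
    have h3 : ∫ z, inner ℂ (coordMonomial x (torusIso u z)) (coordMonomial y (torusIso u z)) ∂ν =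
        ∫ z, inner ℂ (coordMonomial x z) (coordMonomial y z) ∂ν := h
    simp only [h2, integral_const_mul] at h3
    linear_combination (-1 / 2 : ℂ) * h3
  by_cases h1 : y.1 = x.1
  · have h2 : y.2 ≠ x.2 := fun h => hxy (Prod.ext h1.symm h.symm)
    refine key ![1, Circle.exp (Real.pi / ((y.2 : ℝ) - x.2))] ?_
    simpa using circle_exp_pow_mul_conj_pow h2
  · refine key ![Circle.exp (Real.pi / ((y.1 : ℝ) - x.1)), 1] ?_
    simpa using circle_exp_pow_mul_conj_pow h1

theorem MeasureTheory.MeasurePreserving.withDensity_of_invariant {α : Type*} [MeasurableSpace α]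
    {μ : Measure α} {e : α → α} (he : MeasurePreserving e μ μ) {h : α → ℝ≥0∞} (hm : Measurable h)
    (hinv : ∀ a, h (e a) = h a) :
    MeasurePreserving e (μ.withDensity h) (μ.withDensity h) := by
  refine ⟨he.measurable, Measure.ext fun s hs => ?_⟩
  rw [Measure.map_apply he.measurable hs, withDensity_apply _ (he.measurable hs),
    withDensity_apply _ hs, ← he.setLIntegral_comp_preimage hs hm]
  simp only [hinv]

theorem eggDensity_torusIso (u : Fin 2 → Circle) (z : C2) :
    eggDensity p (torusIso u z) = eggDensity p z := by
  simp [eggDensity, torusIso_apply, Circle.norm_coe]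

theorem measurePreserving_torusIso_eggOmega (hp : 0 < p) (u : Fin 2 → Circle) :
    MeasurePreserving (torusIso u) (eggOmega p) (eggOmega p) := by
  rw [eggOmega_eq hp]
  exact (measurePreserving_torusIso hp u).withDensity_of_invariant
    (measurable_eggDensity p).ennreal_ofReal fun z => by rw [eggDensity_torusIso]

end

noncomputable section

variable {p : ℕ}

/-! ### Moments of the boundary measures -/

theorem pow_two_mul_rpow_div (hp : 0 < p) {r : ℝ} (hr : 0 ≤ r) (j : ℕ) :
    (r ^ (2 * p)) ^ ((j : ℝ) / p) = (r ^ j) ^ 2 := by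
  have hp' : (p : ℝ) ≠ 0 := by exact_mod_cast hp.ne'
  rw [← Real.rpow_natCast r (2 * p), ← Real.rpow_mul hr, ← pow_mul, ← Real.rpow_natCast]
  congr 1
  push_cast
  field_simp

theorem norm_sq_coordMonomial (hp : 0 < p) {z : C2} (hz : eggRho p z = 1) (x : ℕ × ℕ) :
    ‖coordMonomial x z‖ ^ 2 =
      (‖z 0‖ ^ (2 * p)) ^ ((x.1 : ℝ) / p) * (1 - ‖z 0‖ ^ (2 * p)) ^ ((x.2 : ℝ) / p) := by
  have h1 : 1 - ‖z 0‖ ^ (2 * p) = ‖z 1‖ ^ (2 * p) := by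
    have : ‖z 0‖ ^ (2 * p) + ‖z 1‖ ^ (2 * p) = 1 := hz
    linarith
  rw [h1, pow_two_mul_rpow_div hp (norm_nonneg _), pow_two_mul_rpow_div hp (norm_nonneg _),
    coordMonomial, norm_mul, norm_pow, norm_pow, mul_pow]

/-- The weight `β((j+1)/p, (ℓ+1)/p)`. -/
def sigmaWeight (p : ℕ) (x : ℕ × ℕ) : ℝ :=
  eulerBeta (((x.1 : ℝ) + 1) / p) (((x.2 : ℝ) + 1) / p)

/-- The weight `β(j/p + 1, ℓ/p + 1)`. -/
def omegaWeight (p : ℕ) (x : ℕ × ℕ) : ℝ :=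
  eulerBeta ((x.1 : ℝ) / p + 1) ((x.2 : ℝ) / p + 1)

theorem sigmaWeight_pos (hp : 0 < p) (x : ℕ × ℕ) : 0 < sigmaWeight p x :=
  eulerBeta_pos (by positivity) (by positivity)

theorem omegaWeight_pos (p : ℕ) (x : ℕ × ℕ) : 0 < omegaWeight p x :=
  eulerBeta_pos (by positivity) (by positivity)

/-- The shift by `p - 1` matches the factor `|z₁ z₂|^{2(p-1)}` in the density of `ωₚ`, so the
moments of `ωₚ` reduce to those of `σ`. -/
theorem omegaWeight_eq (hp : 0 < p) (x : ℕ × ℕ) :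
    omegaWeight p x = sigmaWeight p (x.1 + (p - 1), x.2 + (p - 1)) := by
  have hp' : (p : ℝ) ≠ 0 := by exact_mod_cast hp.ne'
  have : ((p - 1 : ℕ) : ℝ) = p - 1 := by rw [Nat.cast_sub hp, Nat.cast_one]
  rw [omegaWeight, sigmaWeight]
  push_cast
  rw [this]
  congr 1 <;> field_simp <;> ring

theorem lintegral_sigmaWeight (hp : 0 < p) (x : ℕ × ℕ) :
    ∫⁻ s in Set.Ioo (0 : ℝ) 1,
      ENNReal.ofReal (s ^ ((x.1 : ℝ) / p) * (1 - s) ^ ((x.2 : ℝ) / p)) *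
        ENNReal.ofReal (betaDensity p s) = ENNReal.ofReal (sigmaWeight p x) := by
  rw [sigmaWeight, ← lintegral_beta (by positivity) (by positivity)]
  refine setLIntegral_congr_fun measurableSet_Ioo fun s hs => ?_
  have h1 : (0 : ℝ) < 1 - s := by linarith [hs.2]
  have h0 : 0 < s := hs.1
  rw [← ENNReal.ofReal_mul (by positivity), betaDensity, mul_mul_mul_comm, ← Real.rpow_add h0,
    ← Real.rpow_add h1]
  congr 3 <;> ring

theorem lintegral_norm_sq_coordMonomial_eggSigma (hp : 0 < p) : ∃ C : NNReal, C ≠ 0 ∧ ∀ x,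
    ∫⁻ z, ENNReal.ofReal (‖coordMonomial x z‖ ^ 2) ∂eggSigma p ≤
        C * ENNReal.ofReal (sigmaWeight p x) ∧
      ENNReal.ofReal (sigmaWeight p x) ≤
        C * ∫⁻ z, ENNReal.ofReal (‖coordMonomial x z‖ ^ 2) ∂eggSigma p := by
  obtain ⟨C, hC0, hC⟩ := lintegral_eggSigma_comparison hp
  refine ⟨C, hC0, fun x => ?_⟩
  have h := hC (fun s => ENNReal.ofReal (s ^ ((x.1 : ℝ) / p) * (1 - s) ^ ((x.2 : ℝ) / p)))
    (by fun_prop)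
  rw [lintegral_sigmaWeight hp x] at h
  have e : ∫⁻ z, ENNReal.ofReal (‖coordMonomial x z‖ ^ 2) ∂eggSigma p =
      ∫⁻ z, ENNReal.ofReal ((‖z 0‖ ^ (2 * p)) ^ ((x.1 : ℝ) / p) *
        (1 - ‖z 0‖ ^ (2 * p)) ^ ((x.2 : ℝ) / p)) ∂eggSigma p := by
    refine lintegral_congr_ae ?_
    filter_upwards [ae_eggSigma_eggRho hp] with z hz
    rw [norm_sq_coordMonomial hp hz]
  rwa [e]

theorem norm_sq_coordMonomial_add (x : ℕ × ℕ) (n : ℕ) (z : C2) :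
    ‖coordMonomial (x.1 + n, x.2 + n) z‖ ^ 2 =
      (‖z 0‖ * ‖z 1‖) ^ (2 * n) * ‖coordMonomial x z‖ ^ 2 := by
  simp only [coordMonomial, norm_mul, norm_pow]
  ring

theorem lintegral_norm_sq_coordMonomial_eggOmega (hp : 0 < p) : ∃ C : NNReal, C ≠ 0 ∧ ∀ x,
    ∫⁻ z, ENNReal.ofReal (‖coordMonomial x z‖ ^ 2) ∂eggOmega p ≤
        C * ENNReal.ofReal (omegaWeight p x) ∧
      ENNReal.ofReal (omegaWeight p x) ≤
        C * ∫⁻ z, ENNReal.ofReal (‖coordMonomial x z‖ ^ 2) ∂eggOmega p := by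
  have hp1 : (1 : ℝ) ≤ p := by exact_mod_cast hp
  obtain ⟨C, hC0, hC⟩ := lintegral_norm_sq_coordMonomial_eggSigma hp
  have hmono : ∀ x, Measurable fun z : C2 => ENNReal.ofReal (‖coordMonomial x z‖ ^ 2) := fun x =>
    ((continuous_coordMonomial x).norm.pow 2).measurable.ennreal_ofReal
  refine ⟨4 * p * C, by simp [hC0, hp.ne'], fun x => ?_⟩
  have h := hC (x.1 + (p - 1), x.2 + (p - 1))
  rw [← omegaWeight_eq hp] at h
  have e : ∫⁻ z, ENNReal.ofReal (‖coordMonomial x z‖ ^ 2) ∂eggOmega p =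
      ∫⁻ z, ENNReal.ofReal (eggDensity p z * ‖coordMonomial x z‖ ^ 2) ∂eggSigma p := by
    rw [eggOmega_eq hp, lintegral_withDensity_eq_lintegral_mul _
      (measurable_eggDensity p).ennreal_ofReal (hmono x)]
    refine lintegral_congr_ae ?_
    filter_upwards [ae_eggSigma_eggRho hp] with z hz
    have h0 : 0 ≤ eggDensity p z := le_trans (by positivity) (eggDensity_bounds hp hz).1
    simp [ENNReal.ofReal_mul h0]
  have hu : ∫⁻ z, ENNReal.ofReal (‖coordMonomial x z‖ ^ 2) ∂eggOmega p ≤ (4 * p : ℝ≥0∞) *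
      ∫⁻ z, ENNReal.ofReal (‖coordMonomial (x.1 + (p - 1), x.2 + (p - 1)) z‖ ^ 2) ∂eggSigma p := by
    rw [e, ← lintegral_const_mul _ (hmono _)]
    refine lintegral_mono_ae ?_
    filter_upwards [ae_eggSigma_eggRho hp] with z hz
    have h4 : (4 * p : ℝ≥0∞) = ENNReal.ofReal (4 * p) := by
      rw [ENNReal.ofReal_mul (by norm_num)]; simp
    rw [h4, ← ENNReal.ofReal_mul (by positivity), norm_sq_coordMonomial_add, ← mul_assoc]
    exact ENNReal.ofReal_le_ofReal
      (mul_le_mul_of_nonneg_right (eggDensity_bounds hp hz).2 (by positivity))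
  have hl : ∫⁻ z, ENNReal.ofReal (‖coordMonomial (x.1 + (p - 1), x.2 + (p - 1)) z‖ ^ 2)
      ∂eggSigma p ≤ ∫⁻ z, ENNReal.ofReal (‖coordMonomial x z‖ ^ 2) ∂eggOmega p := by
    rw [e]
    refine lintegral_mono_ae ?_
    filter_upwards [ae_eggSigma_eggRho hp] with z hz
    rw [norm_sq_coordMonomial_add]
    refine ENNReal.ofReal_le_ofReal (mul_le_mul_of_nonneg_right ?_ (by positivity))
    exact le_trans (le_mul_of_one_le_left (by positivity) hp1) (eggDensity_bounds hp hz).1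
  have hc : (C : ℝ≥0∞) ≤ ((4 * p * C : NNReal) : ℝ≥0∞) := by
    have : (1 : NNReal) ≤ 4 * p := by
      have : (1 : NNReal) ≤ p := by exact_mod_cast hp
      calc (1 : NNReal) = 1 * 1 := (one_mul 1).symm
        _ ≤ 4 * p := mul_le_mul' (by norm_num) this
    exact_mod_cast le_mul_of_one_le_left (zero_le) this
  constructor
  · calc _ ≤ _ := hu
      _ ≤ (4 * p : ℝ≥0∞) * (C * ENNReal.ofReal (omegaWeight p x)) := mul_le_mul' le_rfl h.1
      _ = _ := by push_cast; ring
  · exact h.2.trans (mul_le_mul' hc hl)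

theorem integral_norm_sq_bounds {ν : Measure C2} {w : ℕ × ℕ → ℝ} (hw : ∀ x, 0 ≤ w x) {C : NNReal}
    (hC : C ≠ 0) {x : ℕ × ℕ}
    (hu : ∫⁻ z, ENNReal.ofReal (‖coordMonomial x z‖ ^ 2) ∂ν ≤ C * ENNReal.ofReal (w x))
    (hl : ENNReal.ofReal (w x) ≤ C * ∫⁻ z, ENNReal.ofReal (‖coordMonomial x z‖ ^ 2) ∂ν) :
    (C : ℝ)⁻¹ * w x ≤ ∫ z, ‖coordMonomial x z‖ ^ 2 ∂ν ∧
      ∫ z, ‖coordMonomial x z‖ ^ 2 ∂ν ≤ C * w x := by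
  have hC' : (0 : ℝ) < C := by exact_mod_cast pos_iff_ne_zero.2 hC
  have hm : Continuous fun z => ‖coordMonomial x z‖ ^ 2 := (continuous_coordMonomial x).norm.pow 2
  rw [integral_eq_lintegral_of_nonneg_ae (Eventually.of_forall fun z => by positivity)
    hm.measurable.aestronglyMeasurable]
  have hfin : (C : ℝ≥0∞) * ENNReal.ofReal (w x) ≠ ∞ :=
    ENNReal.mul_ne_top ENNReal.coe_ne_top ENNReal.ofReal_ne_top
  have hL := ne_top_of_le_ne_top hfin hu
  constructor
  · have := ENNReal.toReal_mono (ENNReal.mul_ne_top ENNReal.coe_ne_top hL) hl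
    rw [ENNReal.toReal_ofReal (hw x), ENNReal.toReal_mul, ENNReal.coe_toReal] at this
    rw [inv_mul_le_iff₀ hC']
    exact this
  · have := ENNReal.toReal_mono hfin hu
    rwa [ENNReal.toReal_mul, ENNReal.coe_toReal, ENNReal.toReal_ofReal (hw x)] at this

theorem exists_moment_bounds_eggSigma (hp : 0 < p) : ∃ c C : ℝ, 0 < c ∧ ∀ x,
    c * sigmaWeight p x ≤ ∫ z, ‖coordMonomial x z‖ ^ 2 ∂eggSigma p ∧
      ∫ z, ‖coordMonomial x z‖ ^ 2 ∂eggSigma p ≤ C * sigmaWeight p x := by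
  obtain ⟨C, hC0, hC⟩ := lintegral_norm_sq_coordMonomial_eggSigma hp
  exact ⟨_, _, inv_pos.2 (by exact_mod_cast pos_iff_ne_zero.2 hC0), fun x =>
    integral_norm_sq_bounds (fun x => (sigmaWeight_pos hp x).le) hC0 (hC x).1 (hC x).2⟩

theorem exists_moment_bounds_eggOmega (hp : 0 < p) : ∃ c C : ℝ, 0 < c ∧ ∀ x,
    c * omegaWeight p x ≤ ∫ z, ‖coordMonomial x z‖ ^ 2 ∂eggOmega p ∧
      ∫ z, ‖coordMonomial x z‖ ^ 2 ∂eggOmega p ≤ C * omegaWeight p x := by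
  obtain ⟨C, hC0, hC⟩ := lintegral_norm_sq_coordMonomial_eggOmega hp
  exact ⟨_, _, inv_pos.2 (by exact_mod_cast pos_iff_ne_zero.2 hC0), fun x =>
    integral_norm_sq_bounds (fun x => (omegaWeight_pos p x).le) hC0 (hC x).1 (hC x).2⟩

theorem isEggMeasure_eggSigma (hp : 0 < p) : IsEggMeasure p (eggSigma p) where
  finite := by
    obtain ⟨C, -, hC⟩ := lintegral_norm_sq_coordMonomial_eggSigma hp
    refine ⟨lt_of_le_of_lt ?_ (ENNReal.mul_lt_top (ENNReal.coe_lt_top (r := C))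
      (ENNReal.ofReal_lt_top (r := sigmaWeight p 0)))⟩
    simpa [coordMonomial] using (hC 0).1
  support_eq := support_eggSigma hp
  orthogonal _ _ hxy := integral_inner_coordMonomial_eq_zero (measurePreserving_torusIso hp) hxy
  norm_pos x := by
    obtain ⟨c, C, hc, h⟩ := exists_moment_bounds_eggSigma hp
    exact lt_of_lt_of_le (mul_pos hc (sigmaWeight_pos hp x)) (h x).1

theorem isEggMeasure_eggOmega (hp : 0 < p) : IsEggMeasure p (eggOmega p) where
  finite := by
    have := (isEggMeasure_eggSigma hp).finite
    refine ⟨lt_of_le_of_lt (eggOmega_le hp Set.univ) ?_⟩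
    rw [Measure.smul_apply, smul_eq_mul]
    exact ENNReal.mul_lt_top (ENNReal.mul_lt_top (by simp) (by simp)) (measure_lt_top _ _)
  support_eq := support_eggOmega hp
  orthogonal _ _ hxy :=
    integral_inner_coordMonomial_eq_zero (measurePreserving_torusIso_eggOmega hp) hxy
  norm_pos x := by
    obtain ⟨c, C, hc, h⟩ := exists_moment_bounds_eggOmega hp
    exact lt_of_lt_of_le (mul_pos hc (omegaWeight_pos p x)) (h x).1

end

noncomputable section

variable {p : ℕ}

/-! ### Comparison of the two Hardy spaces -/

theorem IsEggSeries.congr {ν : Measure C2} {a : ℕ × ℕ → ℂ} {f g : C2 → ℂ}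
    (h : IsEggSeries p ν a f) (hfg : f =ᵐ[ν] g) : IsEggSeries p ν a g := by
  refine Filter.Tendsto.congr (fun S => eLpNorm_congr_ae ?_) h
  filter_upwards [hfg] with z hz
  rw [hz]

theorem IsEggSeries.of_le_smul {μ ν : Measure C2} {c : ℝ≥0∞} (hc : c ≠ ∞) (hle : ν ≤ c • μ)
    {a : ℕ × ℕ → ℂ} {f : C2 → ℂ} (h : IsEggSeries p μ a f) : IsEggSeries p ν a f := by
  have hc' : c ^ (1 / (2 : ℝ≥0∞).toReal) ≠ ∞ := ENNReal.rpow_ne_top_of_nonneg (by simp) hc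
  have h2 := ENNReal.Tendsto.const_mul h (Or.inr hc')
  rw [mul_zero] at h2
  refine tendsto_of_tendsto_of_tendsto_of_le_of_le tendsto_const_nhds h2 (fun _ => zero_le)
    fun S => ?_
  refine (eLpNorm_mono_measure _ hle).trans (le_of_eq ?_)
  rw [eLpNorm_smul_measure_of_ne_top (by simp), smul_eq_mul]
  simp

namespace IsEggMeasure

variable {ν : Measure C2}

theorem mem_hardyFunctions_iff (hν : IsEggMeasure p ν) (hp : 0 < p) (f : C2 → ℂ) :
    f ∈ hardyFunctions (egg p) ν ↔ MemLp f 2 ν ∧ ∃ a, IsEggSeries p ν a f := by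
  simp only [hardyFunctions, hν.hardySpace_eq hp, Set.mem_ofPred_eq,
    ← hν.isEggSeries_iff_hasSum hp]
  constructor
  · rintro ⟨hf, a, ha⟩
    exact ⟨hf, a, ha.congr hf.coeFn_toLp⟩
  · rintro ⟨hf, a, ha⟩
    exact ⟨hf, a, ha.congr hf.coeFn_toLp.symm⟩

theorem eq_of_isEggSeries (hν : IsEggMeasure p ν) (hp : 0 < p) {a b : ℕ × ℕ → ℂ} {f : Lp ℂ 2 ν}
    (ha : IsEggSeries p ν a f) (hb : IsEggSeries p ν b f) : a = b :=
  eq_of_hasSum_of_orthogonal (hν.pairwise_inner_basisVector hp) (hν.basisVector_ne_zero hp)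
    ((hν.isEggSeries_iff_hasSum hp a f).1 ha) ((hν.isEggSeries_iff_hasSum hp b f).1 hb)

/-- The same coefficients serve for both measures, as the `L²(ν)` norm is bounded by a multiple of
the `L²(μ)` norm. -/
theorem hardyFunctions_subset {μ : Measure C2} (hμ : IsEggMeasure p μ) (hν : IsEggMeasure p ν)
    (hp : 0 < p) {c : ℝ≥0∞} (hc : c ≠ ∞) (hle : ν ≤ c • μ) :
    hardyFunctions (egg p) μ ⊆ hardyFunctions (egg p) ν := by
  intro f hf
  obtain ⟨hm, a, ha⟩ := (hμ.mem_hardyFunctions_iff hp f).1 hf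
  exact (hν.mem_hardyFunctions_iff hp f).2 ⟨hm.of_measure_le_smul hc hle, a, ha.of_le_smul hc hle⟩

end IsEggMeasure

/-! ### A function in the larger space only -/

theorem eulerBeta_one_left {y : ℝ} (hy : 0 < y) : eulerBeta 1 y = 1 / y := by
  rw [eulerBeta]
  simp only [sub_self, Real.rpow_zero, one_mul]
  rw [intervalIntegral.integral_comp_sub_left (fun s : ℝ => s ^ (y - 1)) 1,
    integral_rpow (Or.inl (by linarith))]
  simp [hy.ne']

theorem rpow_le_eulerBeta {x y : ℝ} (hx : 0 < x) (hx1 : x ≤ 1) (hy : 0 < y) {n : ℕ} (hn : 1 ≤ n)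
    (hyn : y ≤ n) : (n : ℝ) ^ (-x) / 4 ≤ eulerBeta x y := by
  -- Only the mass on `(0, δ)` with `δ = 1/(2n)` is used. There `s^{x-1} ≥ δ^{x-1}` because `x ≤ 1`,
  -- and `(1-s)^{y-1} ≥ (1-s)^n ≥ 1/2` by Bernoulli. This gives `δ^x / 2`, and `2^x ≤ 2` turns it
  -- into `n^{-x} / 4`.
  have hn' : (1 : ℝ) ≤ n := by exact_mod_cast hn
  have hn0 : (0 : ℝ) < n := by linarith
  set δ : ℝ := 1 / (2 * n) with hδ
  have hδ0 : 0 < δ := by positivity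
  have hδ1 : δ < 1 := by
    rw [hδ, div_lt_one (by positivity)]; linarith
  have hnδ : n * δ = 1 / 2 := by rw [hδ]; field_simp
  have hsub : Set.Ioo 0 δ ⊆ Set.Ioo (0 : ℝ) 1 := Set.Ioo_subset_Ioo_right hδ1.le
  have hbeta := integrableOn_beta hx hy
  have hpt : ∀ s ∈ Set.Ioo 0 δ, δ ^ (x - 1) / 2 ≤ s ^ (x - 1) * (1 - s) ^ (y - 1) := by
    intro s hs
    have h1 : 0 < 1 - s := by linarith [hs.2]
    have hbern : (1 : ℝ) / 2 ≤ (1 - s) ^ n := by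
      have := one_add_mul_le_pow (a := -s) (by linarith [hs.2]) n
      have h3 : (n : ℝ) * s ≤ n * δ := by have := hs.2.le; gcongr
      rw [← sub_eq_add_neg] at this
      linarith
    have h2 : (1 : ℝ) / 2 ≤ (1 - s) ^ (y - 1) := by
      refine hbern.trans ?_
      rw [← Real.rpow_natCast]
      exact Real.rpow_le_rpow_of_exponent_ge h1 (by linarith [hs.1]) (by linarith)
    have h4 : δ ^ (x - 1) ≤ s ^ (x - 1) :=
      Real.rpow_le_rpow_of_nonpos hs.1 hs.2.le (by linarith)
    have h5 : 0 ≤ s ^ (x - 1) := Real.rpow_nonneg hs.1.le _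
    have := mul_le_mul h4 h2 (by norm_num) h5
    linarith
  have hstep : δ ^ x / 2 ≤ eulerBeta x y := by
    rw [eulerBeta_eq_setIntegral]
    calc δ ^ x / 2 = ∫ _ in Set.Ioo 0 δ, δ ^ (x - 1) / 2 := by
          rw [setIntegral_const]
          simp [hδ0.le, Real.rpow_sub_one hδ0.ne']
          field_simp
      _ ≤ ∫ s in Set.Ioo 0 δ, s ^ (x - 1) * (1 - s) ^ (y - 1) :=
          setIntegral_mono_on (integrableOn_const (by simp)) (hbeta.mono_set hsub)
            measurableSet_Ioo hpt
      _ ≤ _ := by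
          refine setIntegral_mono_set hbeta ?_ (Eventually.of_forall hsub)
          refine (ae_restrict_mem measurableSet_Ioo).mono fun s hs => ?_
          have h1 : (0 : ℝ) < 1 - s := by linarith [hs.2]
          have := hs.1
          positivity
  refine le_trans ?_ hstep
  have h2 : (2 : ℝ) ^ x ≤ 2 := by
    simpa using Real.rpow_le_rpow_of_exponent_le (by norm_num : (1 : ℝ) ≤ 2) hx1
  have h2' : 0 < (2 : ℝ) ^ x := by positivity
  have hnx : 0 < (n : ℝ) ^ x := by positivity
  rw [hδ, one_div, Real.inv_rpow (by positivity), Real.mul_rpow (by norm_num) hn0.le,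
    Real.rpow_neg hn0.le, ← one_div, ← one_div, div_div, div_div]
  apply one_div_le_one_div_of_le (by positivity)
  nlinarith

/-- Coefficients on `j = 0` with `|a_ℓ|² = (ℓ+1)^{-(1-1/p)}`. -/
def separatingCoeff (p : ℕ) (x : ℕ × ℕ) : ℂ :=
  if x.1 = 0 then (((x.2 + 1 : ℕ) : ℝ) ^ (-(1 - 1 / (p : ℝ)) / 2) : ℝ) else 0

theorem norm_sq_separatingCoeff (p l : ℕ) :
    ‖separatingCoeff p (0, l)‖ ^ 2 = ((l + 1 : ℕ) : ℝ) ^ (-(1 - 1 / (p : ℝ))) := by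
  rw [separatingCoeff, if_pos rfl, Complex.norm_real, Real.norm_of_nonneg (by positivity),
    ← Real.rpow_natCast, ← Real.rpow_mul (by positivity)]
  congr 1
  push_cast
  ring

theorem summable_separatingCoeff_iff (w : ℕ × ℕ → ℝ) :
    (Summable fun x => ‖separatingCoeff p x‖ ^ 2 * w x) ↔
      Summable fun l : ℕ => ((l + 1 : ℕ) : ℝ) ^ (-(1 - 1 / (p : ℝ))) * w (0, l) := by
  have hinj : Function.Injective fun l : ℕ => ((0, l) : ℕ × ℕ) := fun a b h => by simpa using h
  rw [← hinj.summable_iff]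
  · simp only [Function.comp_def, norm_sq_separatingCoeff]
  · rintro ⟨j, l⟩ h
    have : j ≠ 0 := fun hj => h ⟨l, by simp [hj]⟩
    simp [separatingCoeff, this]

/-- Here `β(1, ℓ/p + 1) = p/(ℓ + p) ≤ p/(ℓ + 1)`, so the terms are at most `p (ℓ+1)^{-(2-1/p)}`; the
exponent `2 - 1/p` exceeds `1` exactly when `p > 1`. -/
theorem omegaSummable_separatingCoeff (hp : 1 < p) : OmegaSummable p (separatingCoeff p) := by
  have hp' : (1 : ℝ) < p := by exact_mod_cast hp
  have hp0 : (0 : ℝ) < p := by linarith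
  refine (summable_separatingCoeff_iff (omegaWeight p)).2 ?_
  have hs : Summable fun l : ℕ => ((l + 1 : ℕ) : ℝ) ^ (-(2 - 1 / (p : ℝ))) := by
    refine (summable_nat_add_iff 1 (f := fun l : ℕ => (l : ℝ) ^ (-(2 - 1 / (p : ℝ))))).2 ?_
    rw [Real.summable_nat_rpow]
    have : 1 / (p : ℝ) < 1 := by rw [div_lt_one hp0]; exact hp'
    linarith
  refine Summable.of_nonneg_of_le
    (fun l => mul_nonneg (by positivity) (omegaWeight_pos p _).le) (fun l => ?_) (hs.mul_left (p : ℝ))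
  have hl : (0 : ℝ) < ((l + 1 : ℕ) : ℝ) := by positivity
  have hw : omegaWeight p (0, l) ≤ p * ((l + 1 : ℕ) : ℝ) ^ (-1 : ℝ) := by
    have : omegaWeight p (0, l) = 1 / ((l : ℝ) / p + 1) := by
      rw [omegaWeight, ← eulerBeta_one_left (by positivity)]
      simp
    rw [this, Real.rpow_neg_one, ← div_eq_mul_inv, div_le_div_iff₀ (by positivity) hl]
    push_cast
    field_simp
    linarith
  calc _ ≤ ((l + 1 : ℕ) : ℝ) ^ (-(1 - 1 / (p : ℝ))) * (p * ((l + 1 : ℕ) : ℝ) ^ (-1 : ℝ)) := by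
        gcongr
    _ = _ := by
        rw [mul_left_comm, ← Real.rpow_add hl]
        congr 2
        ring

/-- Since `β(1/p, (ℓ+1)/p) ≥ (ℓ+1)^{-1/p} / 4`, the terms dominate `1/(4(ℓ+1))`. -/
theorem not_sigmaSummable_separatingCoeff (hp : 0 < p) :
    ¬ SigmaSummable p (separatingCoeff p) := by
  have hp' : (1 : ℝ) ≤ p := by exact_mod_cast hp
  have hp0 : (0 : ℝ) < p := by linarith
  intro h
  have h' := (summable_separatingCoeff_iff (sigmaWeight p)).1 h
  have hs : Summable fun l : ℕ => ((l + 1 : ℕ) : ℝ) ^ (-1 : ℝ) := by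
    refine Summable.of_nonneg_of_le (fun l => by positivity) (fun l => ?_) (h'.mul_left 4)
    have hl : (0 : ℝ) < ((l + 1 : ℕ) : ℝ) := by positivity
    have hw : ((l + 1 : ℕ) : ℝ) ^ (-(1 / (p : ℝ))) / 4 ≤ sigmaWeight p (0, l) := by
      have := rpow_le_eulerBeta (x := 1 / (p : ℝ)) (y := ((l : ℝ) + 1) / p) (n := l + 1)
        (by positivity) (by rw [div_le_one hp0]; exact hp') (by positivity) (by omega)
        (by push_cast; exact div_le_self (by positivity) hp')
      simpa [sigmaWeight] using this
    calc ((l + 1 : ℕ) : ℝ) ^ (-1 : ℝ)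
        = 4 * (((l + 1 : ℕ) : ℝ) ^ (-(1 - 1 / (p : ℝ))) *
          (((l + 1 : ℕ) : ℝ) ^ (-(1 / (p : ℝ))) / 4)) := by
          rw [mul_div_assoc', ← Real.rpow_add hl]
          have : -(1 - 1 / (p : ℝ)) + -(1 / (p : ℝ)) = -1 := by ring
          rw [this]
          ring
      _ ≤ _ := by gcongr
  have := (summable_nat_add_iff 1 (f := fun l : ℕ => (l : ℝ) ^ (-1 : ℝ))).1 hs
  rw [Real.summable_nat_rpow] at this
  exact lt_irrefl _ this

theorem hardyFunctions_ssubset (hp : 1 < p) :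
    hardyFunctions (egg p) (eggSigma p) ⊂ hardyFunctions (egg p) (eggOmega p) := by
  have hp0 : 0 < p := by omega
  have hσ := isEggMeasure_eggSigma hp0
  have hω := isEggMeasure_eggOmega hp0
  have hc : (4 * p : ℝ≥0∞) ≠ ∞ := ENNReal.mul_ne_top (by simp) (by simp)
  refine Set.ssubset_iff_exists.2
    ⟨hσ.hardyFunctions_subset hω hp0 hc (eggOmega_le hp0), ?_⟩
  obtain ⟨c, C, hc0, hb⟩ := exists_moment_bounds_eggOmega hp0
  obtain ⟨f, hf⟩ := (hω.hardySpace_characterization hp0 hc0 (fun x => (omegaWeight_pos p x).le)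
    (fun x => (hb x).1) (fun x => (hb x).2)).1 _ (omegaSummable_separatingCoeff hp)
  refine ⟨f, (hω.mem_hardyFunctions_iff hp0 f).2 ⟨Lp.memLp f, _, hf⟩, fun hmem => ?_⟩
  obtain ⟨hm, b, hbs⟩ := (hσ.mem_hardyFunctions_iff hp0 f).1 hmem
  -- A `σ`-expansion of `f` also converges to `f` in `L²(ωₚ)`, where coefficients are unique.
  have hab : b = separatingCoeff p :=
    hω.eq_of_isEggSeries hp0 (hbs.of_le_smul hc (eggOmega_le hp0)) hf
  subst hab
  obtain ⟨c', C', hc0', hb'⟩ := exists_moment_bounds_eggSigma hp0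
  have hsum := (hσ.isEggSeries_iff_hasSum hp0 _ (hm.toLp f)).1 (hbs.congr hm.coeFn_toLp.symm)
  exact not_sigmaSummable_separatingCoeff hp0
    ((hσ.summable_iff hp0 hc0' (fun x => (sigmaWeight_pos hp0 x).le)
      (fun x => (hb' x).1) (fun x => (hb' x).2) _).1 hsum.summable)

end

theorem proposition5p2 (p : ℕ) (hp : 0 < p) :
    -- every admissible coefficient family gives a convergent series, and the sums are `𝔥²(𝓔ₚ, σ)`
    ((∀ a : ℕ × ℕ → ℂ, SigmaSummable p a →
        ∃ f : Lp ℂ 2 (eggSigma p), IsEggSeries p (eggSigma p) a f) ∧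
      hardySpace (egg p) (eggSigma p) =
        {f : Lp ℂ 2 (eggSigma p) | ∃ a : ℕ × ℕ → ℂ,
          SigmaSummable p a ∧ IsEggSeries p (eggSigma p) a f}) ∧
    -- the same for `𝔥²(𝓔ₚ, ωₚ)`
    ((∀ a : ℕ × ℕ → ℂ, OmegaSummable p a →
        ∃ f : Lp ℂ 2 (eggOmega p), IsEggSeries p (eggOmega p) a f) ∧
      hardySpace (egg p) (eggOmega p) =
        {f : Lp ℂ 2 (eggOmega p) | ∃ a : ℕ × ℕ → ℂ,
          OmegaSummable p a ∧ IsEggSeries p (eggOmega p) a f}) ∧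
    -- `σ` and `ωₚ` have the same null sets, so that the two spaces can be compared
    (eggSigma p ≪ eggOmega p ∧ eggOmega p ≪ eggSigma p) ∧
    (p = 1 → hardyFunctions (egg p) (eggSigma p) = hardyFunctions (egg p) (eggOmega p)) ∧
    (1 < p → hardyFunctions (egg p) (eggSigma p) ⊂ hardyFunctions (egg p) (eggOmega p)) := by
  have hσ := isEggMeasure_eggSigma hp
  have hω := isEggMeasure_eggOmega hp
  obtain ⟨c, C, hc, hb⟩ := exists_moment_bounds_eggSigma hp
  obtain ⟨c', C', hc', hb'⟩ := exists_moment_bounds_eggOmega hp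
  refine ⟨hσ.hardySpace_characterization hp hc (fun x => (sigmaWeight_pos hp x).le)
      (fun x => (hb x).1) (fun x => (hb x).2),
    hω.hardySpace_characterization hp hc' (fun x => (omegaWeight_pos p x).le)
      (fun x => (hb' x).1) (fun x => (hb' x).2),
    ⟨eggSigma_absolutelyContinuous hp, eggOmega_absolutelyContinuous hp⟩, ?_,
    hardyFunctions_ssubset⟩
  rintro rfl
  -- For `p = 1` each measure is bounded by a multiple of the other: `ω₁ ≤ 4σ` and `σ ≤ ω₁`.
  refine Set.Subset.antisymm
    (hσ.hardyFunctions_subset hω hp (ENNReal.mul_ne_top (by simp) (by simp)) (eggOmega_le hp))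
    (hω.hardyFunctions_subset hσ hp ENNReal.one_ne_top ?_)
  rw [one_smul]
  exact eggSigma_one_le
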